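/- Let $\langle S,\varphi\rangle$ denote a closure system: a finite set $S$ with a closure operator $\varphi$ on its subsets. It is \emph{standard} if $\varphi(\emptyset)=\emptyset$ and $\varphi(\{i\})\setminus\{i\}$ is closed for every $i\in S$. A set $Q\subseteq S$ is \emph{quasi-closed} if it is not closed and $Q\cap X$ is closed for every closed $X\not\supseteq Q$; it is \emph{critical} if moreover no proper subset of $Q$ is quasi-closed with the same closure. The \emph{canonical basis} is the set of implications $\Sigma_C=\{C\to\varphi(C)\setminus C : C \text{ critical}\}$, and its \emph{size} $s(\Sigma_C)$ is the sum of the cardinalities of all its premises and conclusions. For $x\in S$, a set $X\subseteq S$ is a \emph{minimal cover} of $x$ if $x\in\varphi(X)$, $x\notin\varphi(\{y\})$ for all $y\in X$, and $X\subseteq Y$ for every $Y\subseteq S$ such that $x\in\varphi(Y)$ and every $y\in Y$ lies in $\varphi(\{z\})$ for some $z\in X$. Write $x\,D\,y$ if $y$ belongs to some minimal cover of $x$. The system is \emph{without $D$-cycles} if there are no $n>2$ and $x_1,\dots,x_n\in S$ with $x_i\,D\,x_{i+1}$ for $1\le i<n$ and $x_1=x_n$. \textbf{Theorem.} For a standard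 closure system $\langle S,\varphi\rangle$, being without $D$-cycles is equivalent to its lattice of closed sets being without $D$-cycles, where the $D$-relation of a finite lattice is defined on its join irreducible elements in the same way ($X$ is a minimal cover of $x$ if $x\le\bigvee X$, $x\not\le y$ for all $y\in X$, and $X\subseteq Y$ for every set $Y$ of join irreducibles such that $x\le\bigvee Y$ and every $y\in Y$ lies below some element of $X$). There is an algorithm (a multi-stack Turing machine) that, given the canonical basis $\Sigma_C$ of any finite standard closure system, decides in time polynomial in $s(\Sigma_C)$ whether the system is without $D$-cycles. Here the input lists the implications of $\Sigma_C$ in any order, each premise and each conclusion being written as a $0/1$-vector indexed by an arbitrary enumeration of the elements that occur in $\Sigma_C$; if the enumeration also contains elements of $S$ that do not occur in $\Sigma_C$, their number is added to $s(\Sigma_C)$ in the time bound. -/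

import Mathlib

namespace ClosureSys

/-! ### Finite lattices without `D`-cycles -/

section Lattices

variable {L : Type*} [Lattice L] [OrderBot L]

/-- `Y` refines `X`. -/
def Refines (Y X : Finset L) : Prop :=
  ∀ y ∈ Y, ∃ x ∈ X, y ≤ x

/-- `X` is a non-trivial cover of `x` by join irreducible elements. -/
def IsLatticeCover (X : Finset L) (x : L) : Prop :=
  (∀ y ∈ X, SupIrred y) ∧ x ≤ X.sup id ∧ ∀ y ∈ X, ¬ x ≤ y

/-- `X` is a (refinement-)minimal non-trivial cover of `x`. -/
def IsLatticeMinCover (X : Finset L) (x : L) : Prop :=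
  IsLatticeCover X x ∧
    ∀ Y : Finset L, (∀ y ∈ Y, SupIrred y) → x ≤ Y.sup id → Refines Y X → X ⊆ Y

/-- The `D`-relation on the join irreducible elements of `L`. -/
def LatticeD (x y : L) : Prop :=
  SupIrred x ∧ SupIrred y ∧ ∃ X : Finset L, IsLatticeMinCover X x ∧ y ∈ X

variable (L) in
/-- `L` has no `D`-cycle `x₁ D x₂ D ⋯ D xₙ = x₁` with `n > 2`. -/
def LatticeWithoutDCycles : Prop :=
  ¬ ∃ (n : ℕ) (x : ℕ → L), 2 < n ∧ (∀ i, 1 ≤ i → i < n → LatticeD (x i) (x (i + 1))) ∧ x 1 = x n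

end Lattices

/-! ### Finite closure systems `⟨S, φ⟩` -/

section Systems

variable {S : Type*} [Fintype S] [DecidableEq S] (φ : ClosureOperator (Finset S))

/-- The closure lattice `Cl(S, φ)`: closed sets ordered by inclusion, with join `φ (X ∪ Y)`
and meet `X ∩ Y`. -/
instance closedsLattice : Lattice φ.Closeds := φ.gi.liftLattice

instance closedsOrderBot : OrderBot φ.Closeds where
  bot := φ.toCloseds ∅
  bot_le _ := φ.gi.gc.l_le (Finset.empty_subset _)

/-- Standard closure systems. -/
def IsStandard : Prop :=
  φ ∅ = ∅ ∧ ∀ i : S, φ.IsClosed (φ {i} \ {i})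

/-- Quasi-closed sets. -/
def IsQuasiClosed (Q : Finset S) : Prop :=
  ¬ φ.IsClosed Q ∧ ∀ X : Finset S, φ.IsClosed X → ¬ Q ⊆ X → φ.IsClosed (Q ∩ X)

/-- Critical sets: the minimal quasi-closed sets among those with the same closure. -/
def IsCritical (C : Finset S) : Prop :=
  IsQuasiClosed φ C ∧ ∀ Q : Finset S, Q ⊆ C → IsQuasiClosed φ Q → φ Q = φ C → Q = C

open Classical in
/-- The canonical (Duquenne–Guigues) basis `{C → φ(C) \ C : C critical}`; an implication
`A → B` is the pair `(A, B)`. -/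
noncomputable def canonicalBasis : Finset (Finset S × Finset S) :=
  (Finset.univ.filter fun C => IsCritical φ C).image fun C => (C, φ C \ C)

/-- The size `s(Σ)`: the sum of the cardinalities of all premises and conclusions. -/
def basisSize (B : Finset (Finset S × Finset S)) : ℕ :=
  ∑ I ∈ B, (I.1.card + I.2.card)

/-- The elements of `S` that occur in some implication of the set `B`. -/
def occurring (B : Finset (Finset S × Finset S)) : Finset S :=
  B.biUnion fun I => I.1 ∪ I.2

/-- `X ⊆ S` is a non-trivial cover of `x`. Here `y ≤ z` in `S` means `y ∈ φ {z}`. -/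
def IsCover (X : Finset S) (x : S) : Prop :=
  x ∈ φ X ∧ ∀ y ∈ X, x ∉ φ {y}

/-- `X ⊆ S` is a (refinement-)minimal non-trivial cover of `x`. -/
def IsMinCover (X : Finset S) (x : S) : Prop :=
  IsCover φ X x ∧
    ∀ Y : Finset S, x ∈ φ Y → (∀ y ∈ Y, ∃ z ∈ X, y ∈ φ {z}) → X ⊆ Y

/-- The `D`-relation on `S`. -/
def DRel (x y : S) : Prop :=
  ∃ X : Finset S, IsMinCover φ X x ∧ y ∈ X

/-- The closure system has no `D`-cycle `x₁ D x₂ D ⋯ D xₙ = x₁` with `n > 2`. -/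
def WithoutDCycles : Prop :=
  ¬ ∃ (n : ℕ) (x : ℕ → S), 2 < n ∧ (∀ i, 1 ≤ i → i < n → DRel φ (x i) (x (i + 1))) ∧ x 1 = x n

end Systems

/-! ### Writing a set of implications as a word over the alphabet `{0, 1, separator}` -/

section Words

variable {S : Type*} [DecidableEq S]

/-- The characteristic vector of `A` along the enumeration `es`, followed by a separator. -/
def encodeSet (es : List S) (A : Finset S) : List (Option Bool) :=
  es.map (fun x => some (decide (x ∈ A))) ++ [none]

/-- The word of a list of implications: premise and conclusion of each, one after the other. -/
def encodeBasis (es : List S) (l : List (Finset S × Finset S)) : List (Option Bool) :=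
  l.flatMap fun I => encodeSet es I.1 ++ encodeSet es I.2

end Words

end ClosureSys

/-! Call `x` supported by `T` if every critical set `C` with at least two elements and with
`x ∈ φ C \ C` satisfies `x ∈ φ (C ∩ T)`. If `T` contains all `y` with `x D y`, then `x` is
supported by `T`, as such a `C` is a down-set and thus contains a minimal cover of `x`. Conversely,
if all elements of `T` are supported by `T`, then `T` contains all `y` with `x D y` for every `x`
supported by `T`: in a derivation of `x` from the down-set `W` generated by a minimal cover, only
`W ∩ T` is needed, so by minimality the cover lies in `W ∩ T`. Hence the iteration of
`T ↦ {x | x is supported by T}` from `∅` exhausts the well-founded part of `D`, and there are no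
`D`-cycles if and only if it reaches all elements that occur in the canonical basis. One round needs
the closure of `C ∩ T` for each critical set `C`, and no minimal cover is ever computed. -/

/-! ### Structured programs on stacks and their translation to stack machines -/

namespace StackProg

open Turing Function

variable {K : Type} {Γ : K → Type} {σ : Type}

/-- An atomic operation of a stack machine on its register and its stacks. -/
inductive Op (Γ : K → Type) (σ : Type)
  | push (k : K) (f : σ → Γ k) : Op Γ σ
  | pop (k : K) (f : σ → Option (Γ k) → σ) : Op Γ σ
  | load (f : σ → σ) : Op Γ σ

/-- Structured programs over blocks of atomic operations; `loop k c p` repeats `p` as long as the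
top of stack `k` satisfies `c`. -/
inductive Prog (Γ : K → Type) (σ : Type)
  | block (os : List (Op Γ σ)) : Prog Γ σ
  | seq (p q : Prog Γ σ) : Prog Γ σ
  | loop (k : K) (c : Option (Γ k) → Bool) (p : Prog Γ σ) : Prog Γ σ

/-- The contents of the register and of the stacks. -/
abbrev State (Γ : K → Type) (σ : Type) := σ × ∀ k, List (Γ k)

/-- The control points of a program. -/
def Label : Prog Γ σ → Type
  | .block _ => Unit
  | .seq p q => Label p ⊕ Label q
  | .loop _ _ p => Option (Label p)

@[reducible] def labelFintype : ∀ p : Prog Γ σ, Fintype (Label p)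
  | .block _ => inferInstanceAs (Fintype Unit)
  | .seq p q => @instFintypeSum _ _ (labelFintype p) (labelFintype q)
  | .loop _ _ p => @instFintypeOption _ (labelFintype p)

/-- The first control point of a program. -/
def entry : ∀ p : Prog Γ σ, Label p
  | .block _ => ()
  | .seq p _ => Sum.inl (entry p)
  | .loop _ _ _ => none

/-- The machine code of a block that is followed by a given statement. The machine has a Boolean
in its register besides the register of the program: it holds the result of the last loop test
and is `false` outside such tests. -/
def blockCode {Λ : Type} : List (Op Γ σ) → TM2.Stmt Γ Λ (σ × Bool) → TM2.Stmt Γ Λ (σ × Bool)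
  | [], s => s
  | .push k f :: os, s => .push k (fun v => f v.1) (blockCode os s)
  | .pop k f :: os, s => .pop k (fun v a => (f v.1 a, v.2)) (blockCode os s)
  | .load f :: os, s => .load (fun v => (f v.1, v.2)) (blockCode os s)

/-- The machine code at each control point of a program; `next` is performed at its end. -/
def code {Λ : Type} : ∀ p : Prog Γ σ,
    (Label p → Λ) → TM2.Stmt Γ Λ (σ × Bool) → Label p → TM2.Stmt Γ Λ (σ × Bool)
  | .block os, _, next, _ => blockCode os next
  | .seq p q, emb, next, l =>
      Sum.elim (code p (emb ∘ Sum.inl) (.goto fun _ => emb (Sum.inr (entry q))))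
        (code q (emb ∘ Sum.inr) next) l
  | .loop k c p, emb, next, l =>
      Option.elim l
        (.peek k (fun v a => (v.1, c a)) (.branch Prod.snd
          (.load (fun v => (v.1, false)) (.goto fun _ => emb (some (entry p)))) next))
        (code p (emb ∘ some) (.goto fun _ => emb none))

variable [DecidableEq K]

/-- The effect of a block. -/
def runOps : List (Op Γ σ) → State Γ σ → State Γ σ
  | [], s => s
  | .push k f :: os, s => runOps os (s.1, update s.2 k (f s.1 :: s.2 k))
  | .pop k f :: os, s => runOps os (f s.1 (s.2 k).head?, update s.2 k (s.2 k).tail)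
  | .load f :: os, s => runOps os (f s.1, s.2)

/-- `Exec p s s' t`: started in state `s`, the program `p` ends in state `s'` after at most `t`
steps, where a block and a loop test take one step each. -/
inductive Exec : Prog Γ σ → State Γ σ → State Γ σ → ℕ → Prop
  | mono {p s s' t t'} : Exec p s s' t → t ≤ t' → Exec p s s' t'
  | block {os s s'} : runOps os s = s' → Exec (.block os) s s' 1
  | seq {p q s s₁ s₂ t₁ t₂} : Exec p s s₁ t₁ → Exec q s₁ s₂ t₂ → Exec (.seq p q) s s₂ (t₁ + t₂)
  | loop_false {k c p s} : c (s.2 k).head? = false → Exec (.loop k c p) s s 1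
  | loop_true {k c p s s₁ s₂ t₁ t₂} : c (s.2 k).head? = true → Exec p s s₁ t₁ →
      Exec (.loop k c p) s₁ s₂ t₂ → Exec (.loop k c p) s s₂ (t₁ + t₂ + 1)

/-- In `s d r`, the loop has treated the elements of `d` and those of `r` remain. -/
theorem Exec.loop_list {α : Type*} {k : K} {c : Option (Γ k) → Bool} {p : Prog Γ σ} {t : ℕ}
    {s₀ s₁ : State Γ σ} (s : List α → List α → State Γ σ) (l : List α) (hs₀ : s₀ = s [] l)
    (hs₁ : s l [] = s₁) (hnil : c (s₁.2 k).head? = false)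
    (hcons : ∀ d a r, c ((s d (a :: r)).2 k).head? = true)
    (hp : ∀ d, ∀ a ∈ l, ∀ r, Exec p (s d (a :: r)) (s (d ++ [a]) r) t) :
    Exec (.loop k c p) s₀ s₁ (l.length * (t + 1) + 1) := by
  suffices h : ∀ r d, l = d ++ r → Exec (.loop k c p) (s d r) s₁ (r.length * (t + 1) + 1) from
    hs₀ ▸ h l [] rfl
  intro r
  induction r with
  | nil =>
    rintro d rfl
    rw [List.append_nil] at hs₁
    simpa [hs₁] using Exec.loop_false hnil
  | cons a r ih =>
    intro d hd
    refine (Exec.loop_true (hcons d a r) (hp d a (by simp [hd]) r)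
      (ih (d ++ [a]) (by simp [hd]))).mono (le_of_eq ?_)
    rw [List.length_cons]
    ring

/-- Empty a stack. -/
def clear (k : K) : Prog Γ σ :=
  .loop k Option.isSome (.block [.pop k fun v _ => v])

theorem exec_clear (k : K) (s : State Γ σ) :
    Exec (clear k) s (s.1, update s.2 k []) ((s.2 k).length * 2 + 1) :=
  .loop_list (t := 1) (fun _ r => (s.1, update s.2 k r)) (s.2 k) (by simp) rfl (by simp)
    (by simp) fun _ _ _ _ => .block (by simp [runOps])

/-- Empty several stacks. -/
def clearAll : List K → Prog Γ σ
  | [] => .block []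
  | k :: ks => .seq (clear k) (clearAll ks)

theorem exec_clearAll (ks : List K) (s : State Γ σ) {N : ℕ} (hN : ∀ k ∈ ks, (s.2 k).length ≤ N) :
    Exec (clearAll ks) s (s.1, fun k => if k ∈ ks then [] else s.2 k)
      (ks.length * (N * 2 + 1) + 1) := by
  induction ks generalizing s with
  | nil => exact .mono (.block (by simp [runOps])) (by simp)
  | cons k ks ih =>
    have hN' : ∀ k' ∈ ks, (update s.2 k [] k').length ≤ N := fun k' hk' => by
      by_cases h : k' = k
      · subst h
        simp
      · simpa [h] using hN k' (.tail _ hk')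
    have hS : (fun k' => if k' ∈ ks then [] else update s.2 k [] k') =
        fun k' => if k' ∈ k :: ks then [] else s.2 k' := by
      funext k'
      by_cases h : k' = k
      · subst h
        simp
      · simp [h]
    have h := (exec_clear k s).seq (ih (s.1, update s.2 k []) hN')
    rw [hS] at h
    refine h.mono ?_
    rw [List.length_cons, add_mul]
    linarith [hN k (.head _)]

variable {Λ : Type} {M : Λ → TM2.Stmt Γ Λ (σ × Bool)}

/-- The machine with program `M` goes from `a` to `b` in at most `t` steps. -/
def ReachesIn (M : Λ → TM2.Stmt Γ Λ (σ × Bool)) (a b : TM2.Cfg Γ Λ (σ × Bool)) (t : ℕ) : Prop :=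
  Nonempty (StateTransition.EvalsToInTime (TM2.step M) a (some b) t)

theorem ReachesIn.trans {a b c : TM2.Cfg Γ Λ (σ × Bool)} {t₁ t₂ : ℕ}
    (h₁ : ReachesIn M a b t₁) (h₂ : ReachesIn M b c t₂) : ReachesIn M a c (t₁ + t₂) := by
  obtain ⟨h₁⟩ := h₁
  obtain ⟨h₂⟩ := h₂
  rw [add_comm]
  exact ⟨h₁.trans _ _ _ _ _ _ h₂⟩

theorem ReachesIn.mono {a b : TM2.Cfg Γ Λ (σ × Bool)} {t₁ t₂ : ℕ}
    (h : ReachesIn M a b t₁) (ht : t₁ ≤ t₂) : ReachesIn M a b t₂ :=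
  h.map fun h => ⟨h.toEvalsTo, h.steps_le_m.trans ht⟩

theorem ReachesIn.step (l : Λ) (v : σ × Bool) (S : ∀ k, List (Γ k)) :
    ReachesIn M ⟨some l, v, S⟩ (TM2.stepAux (M l) v S) 1 :=
  ⟨⟨⟨1, rfl⟩, le_rfl⟩⟩

theorem stepAux_blockCode (os : List (Op Γ σ)) (next : TM2.Stmt Γ Λ (σ × Bool)) (s : State Γ σ)
    (b : Bool) : TM2.stepAux (blockCode os next) (s.1, b) s.2 =
      TM2.stepAux next ((runOps os s).1, b) (runOps os s).2 := by
  induction os generalizing s with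
  | nil => rfl
  | cons o os ih => cases o <;> simp [blockCode, runOps, ← ih]

theorem Exec.reachesIn {p : Prog Γ σ} {s s' : State Γ σ} {t : ℕ} (h : Exec p s s' t)
    (emb : Label p → Λ) (next : TM2.Stmt Γ Λ (σ × Bool)) (hM : ∀ l, M (emb l) = code p emb next l) :
    ReachesIn M ⟨some (emb (entry p)), (s.1, false), s.2⟩
      (TM2.stepAux next (s'.1, false) s'.2) t := by
  induction h generalizing next with
  | mono _ ht ih => exact (ih emb next hM).mono ht
  | @block os s s' h =>
    have := ReachesIn.step (M := M) (emb (entry (.block os))) (s.1, false) s.2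
    rwa [hM, code, stepAux_blockCode, h] at this
  | seq _ _ ih₁ ih₂ =>
    exact (ih₁ (emb ∘ Sum.inl) _ fun l => hM (Sum.inl l)).trans
      (ih₂ (emb ∘ Sum.inr) next fun l => hM (Sum.inr l))
  | @loop_false k c p s hc =>
    have := ReachesIn.step (M := M) (emb (entry (.loop k c p))) (s.1, false) s.2
    rw [hM] at this
    simpa [code, entry, hc] using this
  | @loop_true k c p s s₁ s₂ t₁ t₂ hc _ _ ih₁ ih₂ =>
    have := ReachesIn.step (M := M) (emb (entry (.loop k c p))) (s.1, false) s.2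
    rw [hM] at this
    simp only [code, entry, Option.elim, TM2.stepAux, hc, cond_true] at this
    refine (this.trans ((ih₁ (emb ∘ some) _ fun l => hM (some l)).trans (ih₂ emb next hM))).mono ?_
    omega

end StackProg

/-! ### The machine -/

namespace DCycleMachine

open StackProg Function

/-- The tapes. Two copies of the input serve for nested passes over the implications, and two
unary counters hold one mark for each element of the enumeration. -/
inductive Tape
  | outer | inner | rounds | closure
  deriving DecidableEq

instance : Fintype Tape where
  elems := {.outer, .inner, .rounds, .closure}
  complete t := by cases t <;> simp

/-- The stacks: the parts of each tape left and right of its head, the vector of cells together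
with a stack for the cells already passed, and the output. -/
inductive Stack
  | left (t : Tape) | right (t : Tape) | vec | vecPassed | out
  deriving DecidableEq, Fintype

/-- The data kept for one element: whether it belongs to the set `T` of the elements already known
to be safe, to the set `U` of the candidates for the next such set, and to the working set `A`. -/
structure Cell where
  safe : Bool
  cand : Bool
  work : Bool
  deriving Inhabited, Fintype

/-- The stack alphabets. -/
abbrev Sym : Stack → Type
  | .left _ | .right _ => Option Bool
  | .vec | .vecPassed => Cell
  | .out => Bool

/-- The register: the symbols being moved, a counter that saturates at `2`, and one flag for each
tape. -/
structure Reg where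
  sym : Option Bool
  cell : Cell
  count : Fin 3
  flag : Tape → Bool
  deriving Fintype

/-- The state of the machine between two blocks, apart from the counter, `vecPassed` and `out`. -/
@[ext] structure Memory where
  left : Tape → List (Option Bool) := fun _ => []
  right : Tape → List (Option Bool) := fun _ => []
  vec : List Cell := []
  flag : Tape → Bool := fun _ => false

/-- Programs of the machine. -/
abbrev Program := Prog Sym Reg

/-! #### Contents of the memory -/

/-- The stacks with the given contents. -/
def Memory.stacks (m : Memory) (passed : List Cell) (out : List Bool) : ∀ k, List (Sym k)
  | .left t => m.left t
  | .right t => m.right t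
  | .vec => m.vec
  | .vecPassed => passed
  | .out => out

/-- The state in the middle of a walk along the vector. -/
def Memory.midState (m : Memory) (count : Fin 3) (passed : List Cell) : State Sym Reg :=
  (⟨none, default, count, m.flag⟩, m.stacks passed [])

/-- The state before and after a program. -/
def Memory.state (m : Memory) : State Sym Reg :=
  m.midState 0 []

/-- The memory with `p` left of the head of tape `t`, in reverse order, and `r` right of it. -/
def Memory.seek (m : Memory) (t : Tape) (p r : List (Option Bool)) : Memory :=
  { m with left := update m.left t p, right := update m.right t r }

/-- The head of tape `t` is at the left end of the word `w`. -/
def Memory.Holds (m : Memory) (t : Tape) (w : List (Option Bool)) : Prop :=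
  m.left t = [] ∧ m.right t = w

theorem Memory.Holds.seek_eq {m : Memory} {t : Tape} {w : List (Option Bool)} (h : m.Holds t w) :
    m.seek t [] w = m := by
  simp [Memory.seek, ← h.1, ← h.2]

theorem Memory.Holds.seek {m : Memory} {t t' : Tape} {w : List (Option Bool)} (h : m.Holds t w)
    (ht : t ≠ t') (p r : List (Option Bool)) : (m.seek t' p r).Holds t w := by
  simpa [Memory.Holds, Memory.seek, ht] using h

section Stacks

variable (m : Memory) (passed : List Cell) (out : List Bool) (t : Tape)

@[simp] theorem stacks_left : m.stacks passed out (.left t) = m.left t := rfl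

@[simp] theorem stacks_right : m.stacks passed out (.right t) = m.right t := rfl

@[simp] theorem stacks_vec : m.stacks passed out .vec = m.vec := rfl

@[simp] theorem stacks_vecPassed : m.stacks passed out .vecPassed = passed := rfl

@[simp] theorem stacks_out : m.stacks passed out .out = out := rfl

@[simp] theorem update_stacks_left (a : List (Option Bool)) :
    update (m.stacks passed out) (.left t) a =
      { m with left := update m.left t a }.stacks passed out :=
  update_eq_iff.2 ⟨by simp, by rintro (_ | _) <;> simp_all⟩

@[simp] theorem update_stacks_right (a : List (Option Bool)) :
    update (m.stacks passed out) (.right t) a =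
      { m with right := update m.right t a }.stacks passed out :=
  update_eq_iff.2 ⟨by simp, by rintro (_ | _) <;> simp_all⟩

@[simp] theorem update_stacks_vec (a : List Cell) :
    update (m.stacks passed out) .vec a = { m with vec := a }.stacks passed out :=
  update_eq_iff.2 ⟨by simp, by rintro (_ | _) <;> simp_all⟩

@[simp] theorem update_stacks_vecPassed (a : List Cell) :
    update (m.stacks passed out) .vecPassed a = m.stacks a out :=
  update_eq_iff.2 ⟨by simp, by rintro (_ | _) <;> simp_all⟩

@[simp] theorem update_stacks_out (a : List Bool) :
    update (m.stacks passed out) .out a = m.stacks passed a :=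
  update_eq_iff.2 ⟨by simp, by rintro (_ | _) <;> simp_all⟩

end Stacks

/-! #### Walks along the vector and along a tape -/

/-- Move the head of a tape one symbol to the right. -/
def advance (t : Tape) : Program :=
  .block [.pop (.right t) fun v a => { v with sym := a.getD none },
    .push (.left t) fun v => v.sym, .load fun v => { v with sym := none }]

/-- Move the head of a tape back to its left end. -/
def rewind (t : Tape) : Program :=
  .loop (.left t) Option.isSome (.block [.pop (.left t) fun v a => { v with sym := a.getD none },
    .push (.right t) fun v => v.sym, .load fun v => { v with sym := none }])

/-- A number as a value of the saturating counter. -/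
def saturate (n : ℕ) : Fin 3 := Fin.ofNat 3 (min n 2)

theorem saturate_saturate_succ (n : ℕ) : saturate (saturate n + 1) = saturate (n + 1) := by
  rcases n with _ | _ | n <;> simp [saturate]

/-- Walk along the vector and the bits on tape `t` in parallel, replace each cell according to `g`
from the flag of `t`, the bit and the cell itself, and count the cells which, together with their
bits, satisfy `q`. -/
def walk (t : Tape) (q : Bool → Cell → Bool) (g : Bool → Bool → Cell → Cell) : Program :=
  .loop .vec Option.isSome (.block [.pop .vec fun v a => { v with cell := a.getD default },
    .pop (.right t) fun v a => { v with sym := a.getD none }, .push (.left t) fun v => v.sym,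
    .push .vecPassed fun v => g (v.flag t) (v.sym.getD false) v.cell,
    .load fun v => ⟨none, default,
      if q (v.sym.getD false) v.cell then saturate (v.count + 1) else v.count, v.flag⟩])

/-- Move the cells that have been passed back to the vector. -/
def rewindVec : Program :=
  .loop .vecPassed Option.isSome (.block [
    .pop .vecPassed fun v a => { v with cell := a.getD default },
    .push .vec fun v => v.cell, .load fun v => { v with cell := default }])

/-- Walk along the vector and tape `t`, and set the flag of `t` by `θ` from the number counted. -/
def sweep (t : Tape) (q : Bool → Cell → Bool) (θ : Fin 3 → Bool)
    (g : Bool → Bool → Cell → Cell) : Program :=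
  .seq (walk t q g) (.seq rewindVec
    (.block [.load fun v => { v with count := 0, flag := update v.flag t (θ v.count) }]))

/-- A sweep along the characteristic vector of a set, including the separator behind it. -/
def sweepSet (t : Tape) (q : Bool → Cell → Bool) (θ : Fin 3 → Bool)
    (g : Bool → Bool → Cell → Cell) : Program :=
  .seq (sweep t q θ g) (advance t)

theorem exec_advance (m : Memory) (t : Tape) (a : Option Bool) (p r : List (Option Bool)) :
    Exec (advance t) (m.seek t p (a :: r)).state (m.seek t (a :: p) r).state 1 :=
  .block (by simp [runOps, Memory.state, Memory.midState, Memory.seek])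

theorem exec_rewind (m : Memory) (t : Tape) (p r : List (Option Bool)) :
    Exec (rewind t) (m.seek t p r).state (m.seek t [] (p.reverse ++ r)).state
      (p.length * 2 + 1) :=
  .loop_list (t := 1) (fun d q => (m.seek t q (d.reverse ++ r)).state) p
    rfl rfl (by simp [Memory.state, Memory.midState, Memory.seek])
    (by simp [Memory.state, Memory.midState, Memory.seek])
    fun _ _ _ _ => .block (by simp [runOps, Memory.state, Memory.midState, Memory.seek])

section Sweep

variable {α : Type*} (m : Memory) (t : Tape) (q : Bool → Cell → Bool) (θ : Fin 3 → Bool)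
  (g : Bool → Bool → Cell → Cell) (es : List α) (β : α → Bool) (γ : α → Cell)
  (p r : List (Option Bool))

theorem exec_walk :
    Exec (walk t q g)
      ({ m with vec := es.map γ }.seek t p (es.map (some ∘ β) ++ r)).state
      (({ m with vec := [] }.seek t ((es.map (some ∘ β)).reverse ++ p) r).midState
        (saturate (es.countP fun e => q (β e) (γ e)))
        (es.map fun e => g (m.flag t) (β e) (γ e)).reverse)
      (es.length * 2 + 1) :=
  .loop_list (t := 1) (fun d a =>
    ({ m with vec := a.map γ }.seek t ((d.map (some ∘ β)).reverse ++ p)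
      (a.map (some ∘ β) ++ r)).midState (saturate (d.countP fun e => q (β e) (γ e)))
      (d.map fun e => g (m.flag t) (β e) (γ e)).reverse)
    es rfl rfl (by simp [Memory.midState, Memory.seek]) (by simp [Memory.midState, Memory.seek])
    fun _ e _ _ => .block (by
      cases h : q (β e) (γ e) <;>
        simp [runOps, Memory.midState, Memory.seek, h, saturate_saturate_succ])

theorem exec_rewindVec (count : Fin 3) (passed : List Cell) :
    Exec rewindVec ({ m with vec := [] }.midState count passed)
      ({ m with vec := passed.reverse }.midState count []) (passed.length * 2 + 1) :=
  .loop_list (t := 1) (fun d a => { m with vec := d.reverse }.midState count a) passed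
    rfl (by simp) (by simp [Memory.midState]) (by simp [Memory.midState])
    fun _ _ _ _ => .block (by simp [runOps, Memory.midState])

theorem exec_sweep :
    Exec (sweep t q θ g)
      ({ m with vec := es.map γ }.seek t p (es.map (some ∘ β) ++ r)).state
      ({ m with
        vec := es.map fun e => g (m.flag t) (β e) (γ e)
        flag := update m.flag t (θ (saturate (es.countP fun e => q (β e) (γ e)))) }.seek t
          ((es.map (some ∘ β)).reverse ++ p) r).state
      (es.length * 4 + 3) := by
  refine ((exec_walk m t q g es β γ p r).seq ((exec_rewindVec (m.seek t _ r) _ _).seq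
    (.block ?_))).mono ?_
  · simp only [runOps, Memory.midState, Memory.seek, List.reverse_reverse, Memory.state,
      Prod.mk.injEq, true_and]
    rfl
  · simp only [List.length_reverse, List.length_map]
    omega

theorem exec_sweepSet [DecidableEq α] (A : Finset α) :
    Exec (sweepSet t q θ g)
      ({ m with vec := es.map γ }.seek t p (ClosureSys.encodeSet es A ++ r)).state
      ({ m with
        vec := es.map fun e => g (m.flag t) (e ∈ A) (γ e)
        flag := update m.flag t (θ (saturate (es.countP fun e => q (e ∈ A) (γ e)))) }.seek t
          ((ClosureSys.encodeSet es A).reverse ++ p) r).state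
      (es.length * 4 + 4) := by
  simpa [ClosureSys.encodeSet, sweepSet, Function.comp_def] using
    (exec_sweep m t q θ g es (· ∈ A) γ p (none :: r)).seq (exec_advance _ t none _ r)

end Sweep

/-! #### Nested passes -/

/-- Repeat `step`, which consumes one item on tape `t`, until the tape is exhausted, and return to
its left end. -/
def pass (t : Tape) (step : Program) : Program :=
  .seq (.loop (.right t) Option.isSome step) (rewind t)

/-- Perform `p` once for each mark on the counter `t`. -/
def iterate (t : Tape) (p : Program) : Program :=
  pass t (.seq (advance t) p)

/-- The time of a pass over `count` items of total length `len`, at `step` steps each; its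
instance in `ℕ[X]` yields the polynomial bound. -/
def passTime {R : Type*} [CommSemiring R] (count step len : R) : R :=
  count * (step + 1) + 1 + (len * 2 + 1)

/-- The contents of a counter. -/
def marks (n : ℕ) : List (Option Bool) :=
  List.replicate n (some true)

theorem exec_pass {α : Type*} {t : Tape} {step : Program} {stepTime : ℕ} (m : List α → Memory)
    (enc : α → List (Option Bool)) (l : List α) (henc : ∀ a, enc a ≠ [])
    (hstep : ∀ d, ∀ a ∈ l, ∀ p r, Exec step ((m d).seek t p (enc a ++ r)).state
      ((m (d ++ [a])).seek t ((enc a).reverse ++ p) r).state stepTime) :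
    Exec (pass t step) ((m []).seek t [] (l.flatMap enc)).state
      ((m l).seek t [] (l.flatMap enc)).state
      (passTime l.length stepTime (l.flatMap enc).length) := by
  refine .seq (.loop_list (s₁ := ((m l).seek t (l.flatMap enc).reverse []).state)
    (fun d r => ((m d).seek t (d.flatMap enc).reverse (r.flatMap enc)).state) l rfl rfl
    (by simp [Memory.state, Memory.midState, Memory.seek]) (fun d a r => ?_) fun d a ha r => ?_) ?_
  · obtain ⟨b, bs, hb⟩ := List.exists_cons_of_ne_nil (henc a)
    simp [Memory.state, Memory.midState, Memory.seek, hb]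
  · simpa using hstep d a ha (d.flatMap enc).reverse (r.flatMap enc)
  · simpa using exec_rewind (m l) t (l.flatMap enc).reverse []

theorem exec_iterate {α : Type*} {t : Tape} {p : Program} {time : ℕ} (m : α → Memory) (f : α → α)
    (n : ℕ) (hp : ∀ a u r, Exec p ((m a).seek t u r).state ((m (f a)).seek t u r).state time)
    (a : α) :
    Exec (iterate t p) ((m a).seek t [] (marks n)).state ((m (f^[n] a)).seek t [] (marks n)).state
      (passTime n (1 + time) n) := by
  have hmarks : (List.range n).flatMap (fun _ => [some true]) = marks n := by
    simp [marks, List.eq_replicate_iff]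
  have h := exec_pass (t := t) (step := .seq (advance t) p) (stepTime := 1 + time)
    (fun d : List ℕ => m (f^[d.length] a)) (fun _ => [some true]) (List.range n) (by simp)
    fun d _ _ u r => by
      rw [List.length_append, List.length_singleton, Function.iterate_succ_apply']
      exact (exec_advance _ t _ u r).seq (hp _ _ r)
  simpa [iterate, hmarks, marks] using h

/-! #### The algorithm -/

/-- Fire the implication at the head of the inner tape: if its premise lies in `A`, then add its
conclusion to `A`. -/
def innerStep : Program :=
  .seq (sweepSet .inner (fun b c => b && !c.work) (· == 0) fun _ _ c => c)
    (sweepSet .inner (fun _ _ => false) (fun _ => false) fun f b c =>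
      { c with work := c.work || (f && b) })

/-- Close `A` under the implications. -/
def closeWork : Program :=
  iterate .closure (pass .inner innerStep)

/-- Treat the implication `C → B` at the head of the outer tape: if `C` has at least two elements,
then remove from `U` the elements of `B` outside the closure of `C ∩ T`. -/
def outerStep : Program :=
  .seq (sweepSet .outer (fun b _ => b) (· == 2) fun _ b c => { c with work := b && c.safe })
    (.seq closeWork (sweepSet .outer (fun _ _ => false) (fun _ => false) fun f b c =>
      ⟨c.safe, c.cand && !(f && b && !c.work), false⟩))

/-- Replace `T` by `U` and put all elements back into `U`; the counter `closure`, which has one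
mark for each cell, only keeps the walk going. -/
def commit : Program :=
  .seq (sweep .closure (fun _ _ => false) (fun _ => false) fun _ _ c => ⟨c.cand, true, false⟩)
    (rewind .closure)

/-- Replace `T` by the set of the elements that are safe relative to `T`. -/
def nextSafe : Program :=
  .seq (pass .outer outerStep) commit

/-- Count the elements of the first set on the input, with one mark on each counter and one cell
for each of them. -/
def countElements : Program :=
  .loop (.right .outer) (fun a => a.join.isSome) (.block [
    .pop (.right .outer) fun v a => { v with sym := a.getD none },
    .push (.left .outer) fun v => v.sym,
    .push (.right .rounds) fun _ => some true, .push (.right .closure) fun _ => some true,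
    .push .vec fun _ => ⟨false, true, false⟩, .load fun v => { v with sym := none }])

/-- Move the head of the tape `outer` to its right end. -/
def fastForward : Program :=
  .loop (.right .outer) Option.isSome (advance .outer)

/-- Move the head of the tape `outer` back to its left end, writing a copy on the tape `inner`. -/
def copyBack : Program :=
  .loop (.left .outer) Option.isSome (.block [
    .pop (.left .outer) fun v a => { v with sym := a.getD none },
    .push (.right .outer) fun v => v.sym,
    .push (.right .inner) fun v => v.sym, .load fun v => { v with sym := none }])

/-- Write whether all elements are in `T`, and erase everything else. -/
def verdict : Program :=
  .seq (sweep .closure (fun _ c => !c.safe) (· == 0) fun _ _ c => c)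
    (.seq (.block [.push .out fun v => v.flag .closure,
        .load fun v => { v with flag := fun _ => false }])
      (clearAll [.left .closure, .right .outer, .right .inner, .right .rounds, .vec]))

/-- The whole program. -/
def program : Program :=
  .seq (.seq countElements (.seq fastForward copyBack)) (.seq (iterate .rounds nextSafe) verdict)

/-! #### Its effect on sets of elements -/

theorem saturate_eq_zero_iff (n : ℕ) : saturate n = 0 ↔ n = 0 := by
  rcases n with _ | _ | n <;> simp [saturate]

theorem saturate_eq_two_iff (n : ℕ) : saturate n = 2 ↔ 2 ≤ n := by
  rcases n with _ | _ | n
  · decide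
  · decide
  · simp [saturate]

section Sets

variable {α : Type*} [DecidableEq α]

/-- The vector of cells that represents the sets `T`, `U` and `A`. -/
def cells (es : List α) (T U A : Finset α) : List Cell :=
  es.map fun e => ⟨e ∈ T, e ∈ U, e ∈ A⟩

/-- The memory with a vector that represents given sets. -/
def Memory.withSets (m : Memory) (es : List α) (T U A : Finset α) : Memory :=
  { m with vec := cells es T U A }

/-- The word of one implication. -/
def encodeImplication (es : List α) (I : Finset α × Finset α) : List (Option Bool) :=
  ClosureSys.encodeSet es I.1 ++ ClosureSys.encodeSet es I.2

/-- The effect of the implication `I` on `A`. -/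
def fire (A : Finset α) (I : Finset α × Finset α) : Finset α :=
  if I.1 ⊆ A then A ∪ I.2 else A

/-- The set obtained from `A` by firing the implications in `l` one after the other, `n` times. -/
def chase (l : List (Finset α × Finset α)) (n : ℕ) (A : Finset α) : Finset α :=
  (fun A => l.foldl fire A)^[n] A

/-- The effect of the implication `I` on `U`, where `cl` computes closures. -/
def cut (cl : Finset α → Finset α) (T U : Finset α) (I : Finset α × Finset α) : Finset α :=
  if 2 ≤ I.1.card then U \ (I.2 \ cl (I.1 ∩ T)) else U

variable {es : List α} {B : Finset α} (hB : B ⊆ es.toFinset)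

include hB

theorem saturate_countP_diff_eq_zero (A : Finset α) :
    (saturate (es.countP fun e => e ∈ B && !decide (e ∈ A)) == 0) = decide (B ⊆ A) := by
  rw [Bool.eq_iff_iff, beq_iff_eq, decide_eq_true_eq, saturate_eq_zero_iff, List.countP_eq_zero]
  simp only [Bool.and_eq_true, decide_eq_true_eq, Bool.not_eq_true', decide_eq_false_iff_not,
    not_and, not_not]
  exact ⟨fun h e he => h e (List.mem_toFinset.1 (hB he)) he, fun h _ _ he => h he⟩

theorem saturate_countP_mem_eq_two (hes : es.Nodup) :
    (saturate (es.countP (· ∈ B)) == 2) = decide (2 ≤ B.card) := by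
  have h : (es.filter (· ∈ B)).toFinset = B := by
    ext e
    simpa using fun he => List.mem_toFinset.1 (hB he)
  rw [Bool.eq_iff_iff, beq_iff_eq, decide_eq_true_eq, saturate_eq_two_iff,
    List.countP_eq_length_filter, ← List.toFinset_card_of_nodup (hes.filter _), h]

end Sets

section Effects

variable {α : Type*} {m : Memory} {es : List α}

theorem exec_sweep_counter {t : Tape} (q : Cell → Bool) (θ : Fin 3 → Bool) (g : Cell → Cell)
    (γ : α → Cell) (ht : m.Holds t (marks es.length)) :
    Exec (sweep t (fun _ => q) θ fun _ _ => g) { m with vec := es.map γ }.state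
      ({ m with
        vec := es.map fun e => g (γ e)
        flag := update m.flag t (θ (saturate (es.countP fun e => q (γ e)))) }.seek t
          (marks es.length) []).state
      (es.length * 4 + 3) := by
  have hmarks : es.map (some ∘ fun _ => true) = marks es.length := by
    simp [marks, List.eq_replicate_iff]
  have h := exec_sweep m t (fun _ => q) θ (fun _ _ => g) es (fun _ => true) γ [] []
  have hseek : { m with vec := es.map γ }.seek t [] (marks es.length) =
      { m with vec := es.map γ } :=
    Memory.Holds.seek_eq (m := { m with vec := es.map γ }) ht
  have hreverse : (marks es.length).reverse = marks es.length := List.reverse_replicate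
  simpa only [hmarks, List.append_nil, hseek, hreverse] using h

variable [DecidableEq α] {l : List (Finset α × Finset α)}

theorem length_encodeImplication (es : List α) (I : Finset α × Finset α) :
    (encodeImplication es I).length = 2 * es.length + 2 := by
  simp only [encodeImplication, ClosureSys.encodeSet, List.length_append, List.length_map,
    List.length_singleton]
  ring

theorem length_encodeBasis (es : List α) (l : List (Finset α × Finset α)) :
    (ClosureSys.encodeBasis es l).length = l.length * (2 * es.length + 2) := by
  change (l.flatMap (encodeImplication es)).length = _
  simp [List.length_flatMap, length_encodeImplication]

theorem exec_sweepSet_cells (t : Tape) {q : Bool → Cell → Bool} {θ : Fin 3 → Bool}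
    {g : Bool → Bool → Cell → Cell} {B T U A T' U' A' : Finset α} {flag : Bool}
    (hflag : θ (saturate (es.countP fun e => q (e ∈ B) ⟨e ∈ T, e ∈ U, e ∈ A⟩)) = flag)
    (hg : ∀ e, g (m.flag t) (e ∈ B) ⟨e ∈ T, e ∈ U, e ∈ A⟩ = ⟨e ∈ T', e ∈ U', e ∈ A'⟩)
    (p r : List (Option Bool)) :
    Exec (sweepSet t q θ g)
      ((m.withSets es T U A).seek t p (ClosureSys.encodeSet es B ++ r)).state
      (({ m with flag := update m.flag t flag }.withSets es T' U' A').seek t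
        ((ClosureSys.encodeSet es B).reverse ++ p) r).state (es.length * 4 + 4) := by
  simpa only [hg, hflag] using! exec_sweepSet m t q θ g es (fun e => ⟨e ∈ T, e ∈ U, e ∈ A⟩) p r B

theorem exec_innerStep (hm : m.flag .inner = false) {I : Finset α × Finset α}
    (hI : I.1 ⊆ es.toFinset) (T U A : Finset α) (p r : List (Option Bool)) :
    Exec innerStep
      ((m.withSets es T U A).seek .inner p (encodeImplication es I ++ r)).state
      ((m.withSets es T U (fire A I)).seek .inner ((encodeImplication es I).reverse ++ p) r).state
      (es.length * 8 + 8) := by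
  have test := exec_sweepSet_cells (m := m) (T := T) (U := U) (A := A) (T' := T) (U' := U)
    (A' := A) (B := I.1) (es := es) .inner (q := fun b c => b && !c.work) (θ := (· == 0))
    (g := fun _ _ c => c) (flag := I.1 ⊆ A)
    (saturate_countP_diff_eq_zero hI A) (by simp)
    p (ClosureSys.encodeSet es I.2 ++ r)
  have add := exec_sweepSet_cells (m := { m with flag := update m.flag .inner (I.1 ⊆ A) })
    (T := T) (U := U) (A := A) (T' := T) (U' := U)
    (A' := fire A I) (B := I.2) (es := es) .inner (q := fun _ _ => false) (θ := fun _ => false)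
    (g := fun f b c => { c with work := c.work || (f && b) }) (flag := false) rfl
    (by by_cases h : I.1 ⊆ A <;> simp [fire, h]) ((ClosureSys.encodeSet es I.1).reverse ++ p) r
  have hflag : update (update m.flag .inner (I.1 ⊆ A)) .inner false = m.flag := by
    simp [← hm]
  rw [hflag] at add
  simpa [innerStep, encodeImplication] using (test.seq add).mono (by omega)

/-- The number of steps that closing a set takes, for `n` elements and `k` implications. -/
def closeTime {R : Type*} [CommSemiring R] (n k : R) : R :=
  passTime n (1 + passTime k (n * 8 + 8) (k * (2 * n + 2))) n

theorem exec_fireAll (hinner : m.Holds .inner (ClosureSys.encodeBasis es l))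
    (hflag : m.flag .inner = false) (hpremise : ∀ I ∈ l, I.1 ⊆ es.toFinset) (T U A : Finset α) :
    Exec (pass .inner innerStep) (m.withSets es T U A).state
      (m.withSets es T U (l.foldl fire A)).state
      (passTime l.length (es.length * 8 + 8) (l.length * (2 * es.length + 2))) := by
  have h := exec_pass (t := .inner) (step := innerStep)
    (fun d => m.withSets es T U (d.foldl fire A)) (encodeImplication es) l
    (by simp [encodeImplication, ClosureSys.encodeSet])
    fun d I hI p r => by simpa using exec_innerStep hflag (hpremise I hI) T U (d.foldl fire A) p r
  have hseek (A : Finset α) : (m.withSets es T U A).seek .inner []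
      (l.flatMap (encodeImplication es)) = m.withSets es T U A :=
    hinner.seek_eq (m := m.withSets es T U A)
  rw [← length_encodeBasis]
  simpa only [hseek] using! h

theorem exec_closeWork (hinner : m.Holds .inner (ClosureSys.encodeBasis es l))
    (hcounter : m.Holds .closure (marks es.length)) (hflag : m.flag .inner = false)
    (hpremise : ∀ I ∈ l, I.1 ⊆ es.toFinset) (T U A : Finset α) :
    Exec closeWork (m.withSets es T U A).state (m.withSets es T U (chase l es.length A)).state
      (closeTime es.length l.length) := by
  have h := exec_iterate (t := .closure) (p := pass .inner innerStep) (m.withSets es T U)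
    (fun A => l.foldl fire A) es.length (fun A u r =>
      exec_fireAll (m := m.seek .closure u r) (hinner.seek (by decide) u r) hflag hpremise T U A) A
  have hseek (A : Finset α) :
      (m.withSets es T U A).seek .closure [] (marks es.length) = m.withSets es T U A :=
    hcounter.seek_eq (m := m.withSets es T U A)
  simpa only [hseek] using! h

theorem exec_outerStep (hes : es.Nodup) (hinner : m.Holds .inner (ClosureSys.encodeBasis es l))
    (hcounter : m.Holds .closure (marks es.length)) (hflag : m.flag = fun _ => false)
    (hpremise : ∀ I ∈ l, I.1 ⊆ es.toFinset) {I : Finset α × Finset α} (hI : I ∈ l)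
    (T U : Finset α) (p r : List (Option Bool)) :
    Exec outerStep
      ((m.withSets es T U ∅).seek .outer p (encodeImplication es I ++ r)).state
      ((m.withSets es T (cut (chase l es.length) T U I) ∅).seek .outer
        ((encodeImplication es I).reverse ++ p) r).state
      (es.length * 8 + 8 + closeTime es.length l.length) := by
  set big := decide (2 ≤ I.1.card)
  set m' : Memory := { m with flag := update m.flag .outer big }
  set p₁ := (ClosureSys.encodeSet es I.1).reverse ++ p
  set r₁ := ClosureSys.encodeSet es I.2 ++ r
  have restrict := exec_sweepSet_cells (m := m) (T := T) (U := U) (A := ∅) (T' := T) (U' := U)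
    (A' := I.1 ∩ T) (B := I.1) (es := es) .outer (q := fun b _ => b) (θ := (· == 2))
    (g := fun _ b c => { c with work := b && c.safe }) (flag := big)
    (saturate_countP_mem_eq_two (hpremise I hI) hes) (by simp) p r₁
  have close := exec_closeWork (m := m'.seek .outer p₁ r₁) (hinner.seek (by decide) p₁ r₁)
    (hcounter.seek (by decide) p₁ r₁) (by simp [m', Memory.seek, hflag]) hpremise T U (I.1 ∩ T)
  have remove := exec_sweepSet_cells (m := m') (T := T) (U := U)
    (A := chase l es.length (I.1 ∩ T)) (T' := T) (U' := cut (chase l es.length) T U I)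
    (A' := ∅) (B := I.2) (es := es) .outer
    (q := fun _ _ => false) (θ := fun _ => false)
    (g := fun f b c => ⟨c.safe, c.cand && !(f && b && !c.work), false⟩) (flag := false) rfl
    (fun e => by by_cases h : 2 ≤ I.1.card <;> simp [m', big, cut, h]) p₁ r
  have hm' : { m' with flag := update m'.flag .outer false } = m := by
    simp [m', hflag, Memory.ext_iff]
  rw [hm'] at remove
  simpa [outerStep, encodeImplication, p₁] using!
    (restrict.seq (close.seq remove)).mono (by omega)

/-- The number of steps of one round, for `n` elements and `k` implications. -/
def roundTime {R : Type*} [CommSemiring R] (n k : R) : R :=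
  passTime k (n * 8 + 8 + closeTime n k) (k * (2 * n + 2)) + (n * 6 + 4)

theorem exec_commit (hcounter : m.Holds .closure (marks es.length))
    (hflag : m.flag = fun _ => false) (T U : Finset α) :
    Exec commit (m.withSets es T U ∅).state (m.withSets es U es.toFinset ∅).state
      (es.length * 6 + 4) := by
  have hcells : (es.map fun e => ⟨e ∈ U, true, false⟩) = cells es U es.toFinset ∅ :=
    List.map_congr_left fun e he => by simp [he]
  have hmem : ({ m with
      vec := es.map fun e => ⟨e ∈ U, true, false⟩
      flag := update m.flag .closure false }.seek .closure [] (marks es.length)) =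
      m.withSets es U es.toFinset ∅ := by
    rw [hcells]
    exact (Memory.Holds.seek_eq (m := { m with
      vec := cells es U es.toFinset ∅
      flag := update m.flag .closure false }) hcounter).trans (by simp [Memory.withSets, hflag])
  have h := (exec_sweep_counter (fun _ => false) (fun _ => false) (fun c => ⟨c.cand, true, false⟩)
    (fun e => ⟨e ∈ T, e ∈ U, e ∈ (∅ : Finset α)⟩) hcounter).seq (exec_rewind _ _ _ _)
  simp only [marks, List.reverse_replicate, List.append_nil, List.length_replicate] at h hmem
  rw [hmem] at h
  exact h.mono (by omega)

theorem exec_nextSafe (hes : es.Nodup) (houter : m.Holds .outer (ClosureSys.encodeBasis es l))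
    (hinner : m.Holds .inner (ClosureSys.encodeBasis es l))
    (hcounter : m.Holds .closure (marks es.length)) (hflag : m.flag = fun _ => false)
    (hpremise : ∀ I ∈ l, I.1 ⊆ es.toFinset) (T : Finset α) :
    Exec nextSafe (m.withSets es T es.toFinset ∅).state
      (m.withSets es (l.foldl (cut (chase l es.length) T) es.toFinset) es.toFinset ∅).state
      (roundTime es.length l.length) := by
  have h := exec_pass (t := .outer) (step := outerStep)
    (fun d => m.withSets es T (d.foldl (cut (chase l es.length) T) es.toFinset) ∅)
    (encodeImplication es) l (by simp [encodeImplication, ClosureSys.encodeSet])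
    fun d I hI p r => by
      simpa using exec_outerStep hes hinner hcounter hflag hpremise hI T
        (d.foldl (cut (chase l es.length) T) es.toFinset) p r
  have hseek (U : Finset α) : (m.withSets es T U ∅).seek .outer []
      (l.flatMap (encodeImplication es)) = m.withSets es T U ∅ :=
    houter.seek_eq (m := m.withSets es T U ∅)
  have hlen : (l.flatMap (encodeImplication es)).length = _ := length_encodeBasis es l
  simp only [hseek, hlen] at h
  exact h.seq (exec_commit hcounter hflag T _)

end Effects

/-! #### Complete runs -/

/-- The memory during the preparations, after `n` elements have been counted: the head of the
outer tape is between `p`, in reverse order, and `r`, and `w` has been copied to the inner tape. -/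
def setup (n : ℕ) (p r w : List (Option Bool)) : Memory where
  left
    | .outer => p
    | _ => []
  right
    | .outer => r
    | .inner => w
    | .rounds | .closure => marks n
  vec := List.replicate n ⟨false, true, false⟩

theorem seek_setup (n : ℕ) (p r w p' r' : List (Option Bool)) :
    (setup n p r w).seek .outer p' r' = setup n p' r' w :=
  Memory.ext (update_eq_iff.2 ⟨rfl, by rintro (_ | _) <;> simp [setup]⟩)
    (update_eq_iff.2 ⟨rfl, by rintro (_ | _) <;> simp [setup]⟩) rfl rfl

theorem exec_countElements (bs : List Bool) (r : List (Option Bool)) (hr : r.head?.join = none) :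
    Exec countElements (setup 0 [] (bs.map some ++ r) []).state
      (setup bs.length (bs.map some).reverse r []).state (bs.length * 2 + 1) := by
  refine .loop_list (t := 1)
    (fun d a => (setup d.length (d.map some).reverse (a.map some ++ r) []).state) bs rfl rfl
    (by simpa [Memory.state, Memory.midState, setup] using hr)
    (by simp [Memory.state, Memory.midState, setup])
    fun d b _ a => .block (Prod.ext rfl (funext fun k => ?_))
  rcases k with (_ | _) | (_ | _) | _ | _ | _ <;>
    simp [runOps, Memory.state, Memory.midState, setup, List.replicate_succ, marks]

theorem exec_fastForward (n : ℕ) (p r : List (Option Bool)) :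
    Exec fastForward (setup n p r []).state (setup n (r.reverse ++ p) [] []).state
      (r.length * 2 + 1) := by
  refine .loop_list (t := 1) (fun d a => (setup n (d.reverse ++ p) a []).state) r rfl rfl rfl
    (by simp [Memory.state, Memory.midState, setup]) fun d a _ q => ?_
  simpa [seek_setup] using exec_advance (setup n [] [] []) .outer a (d.reverse ++ p) q

theorem exec_copyBack (n : ℕ) (p : List (Option Bool)) :
    Exec copyBack (setup n p [] []).state (setup n [] p.reverse p.reverse).state
      (p.length * 2 + 1) := by
  refine .loop_list (t := 1) (fun d a => (setup n a d.reverse d.reverse).state) p rfl rfl rfl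
    (by simp [Memory.state, Memory.midState, setup]) fun d a _ q =>
      .block (Prod.ext rfl (funext fun k => ?_))
  rcases k with (_ | _) | (_ | _) | _ | _ | _ <;>
    simp [runOps, Memory.state, Memory.midState, setup]

theorem exec_setup (bs : List Bool) {r w : List (Option Bool)} (hw : bs.map some ++ r = w)
    (hr : r.head?.join = none) :
    Exec (.seq countElements (.seq fastForward copyBack)) (setup 0 [] w []).state
      (setup bs.length [] w w).state (w.length * 4 + 3) := by
  have h := (exec_countElements bs r hr).seq ((exec_fastForward _ _ _).seq (exec_copyBack _ _))
  rw [← List.reverse_append, List.reverse_reverse, hw, List.length_reverse] at h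
  refine h.mono ?_
  simp only [← hw, List.length_append, List.length_map]
  omega

variable {α : Type*} [DecidableEq α] {es : List α} {l : List (Finset α × Finset α)}

/-- The set of the elements that the program has recognized as safe when it stops. -/
def safeSet (es : List α) (l : List (Finset α × Finset α)) : Finset α :=
  (fun T => l.foldl (cut (chase l es.length) T) es.toFinset)^[es.length] ∅

theorem exec_rounds (hes : es.Nodup) (hpremise : ∀ I ∈ l, I.1 ⊆ es.toFinset) {m : Memory}
    (houter : m.Holds .outer (ClosureSys.encodeBasis es l))
    (hinner : m.Holds .inner (ClosureSys.encodeBasis es l))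
    (hrounds : m.Holds .rounds (marks es.length))
    (hcounter : m.Holds .closure (marks es.length)) (hflag : m.flag = fun _ => false) :
    Exec (iterate .rounds nextSafe) (m.withSets es ∅ es.toFinset ∅).state
      (m.withSets es (safeSet es l) es.toFinset ∅).state
      (passTime es.length (1 + roundTime es.length l.length) es.length) := by
  have h := exec_iterate (t := .rounds) (p := nextSafe) (m.withSets es · es.toFinset ∅)
    (fun T => l.foldl (cut (chase l es.length) T) es.toFinset) es.length (fun T u r =>
      exec_nextSafe (m := m.seek .rounds u r) hes (houter.seek (by decide) u r)
        (hinner.seek (by decide) u r) (hcounter.seek (by decide) u r) hflag hpremise T) ∅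
  have hseek (T : Finset α) : (m.withSets es T es.toFinset ∅).seek .rounds [] (marks es.length) =
      m.withSets es T es.toFinset ∅ :=
    hrounds.seek_eq (m := m.withSets es T es.toFinset ∅)
  simpa only [hseek] using! h

/-- The state in which the machine stops with the given answer. -/
def answerState (answer : Bool) : State Sym Reg :=
  (⟨none, default, 0, fun _ => false⟩, ({} : Memory).stacks [] [answer])

theorem exec_verdict (w : List (Option Bool)) (T U A : Finset α) :
    Exec verdict ((setup es.length [] w w).withSets es T U A).state
      (answerState (es.toFinset ⊆ T))
      (es.length * 4 + 3 + (1 + (5 * ((w.length + es.length) * 2 + 1) + 1))) := by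
  have hcount :
      (saturate (es.countP fun e => !decide (e ∈ T)) == 0) = decide (es.toFinset ⊆ T) := by
    rw [Bool.eq_iff_iff, beq_iff_eq, decide_eq_true_eq, saturate_eq_zero_iff, List.countP_eq_zero]
    simp [Finset.subset_iff]
  have hsweep := exec_sweep_counter (m := setup es.length [] w w) (es := es) (t := .closure)
    (fun c => !c.safe) (· == 0) id (fun e => ⟨e ∈ T, e ∈ U, e ∈ A⟩) ⟨rfl, rfl⟩
  rw [hcount] at hsweep
  let m : Memory :=
    { setup es.length [] w w with vec := cells es T U A }.seek .closure (marks es.length) []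
  have hclear := exec_clearAll
    [Stack.left .closure, .right .outer, .right .inner, .right .rounds, .vec]
    ((⟨none, default, 0, fun _ => false⟩ : Reg), m.stacks [] [decide (es.toFinset ⊆ T)])
    (N := w.length + es.length) (by simp [m, Memory.seek, setup, marks, cells])
  have hfinal : (answerState (es.toFinset ⊆ T)).2 = fun k =>
      if k ∈ [Stack.left .closure, .right .outer, .right .inner, .right .rounds, .vec] then []
      else m.stacks [] [decide (es.toFinset ⊆ T)] k := by
    funext k
    rcases k with (_ | _) | (_ | _) | _ | _ | _ <;> simp [m, answerState, Memory.seek, setup]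
  rw [← hfinal] at hclear
  refine hsweep.seq (.seq (.block ?_) hclear)
  simp only [runOps, Memory.state, Memory.midState, Memory.seek, setup, id_eq, update_self,
    stacks_out, update_stacks_out, cells, Prod.mk.injEq, true_and, m]
  rfl

/-- The number of steps of the program, for `n` elements and `k` implications. -/
def programTime {R : Type*} [CommSemiring R] (n k : R) : R :=
  k * (2 * n + 2) * 4 + 3 + (passTime n (1 + roundTime n k) n +
    (n * 4 + 3 + (1 + (5 * ((k * (2 * n + 2) + n) * 2 + 1) + 1))))

theorem exec_program_of_elements (hes : es.Nodup) (hpremise : ∀ I ∈ l, I.1 ⊆ es.toFinset)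
    (hempty : l = [] → es = []) :
    Exec program (setup 0 [] (ClosureSys.encodeBasis es l) []).state
      (answerState (es.toFinset ⊆ safeSet es l)) (programTime es.length l.length) := by
  set w := ClosureSys.encodeBasis es l with hw
  obtain ⟨bs, r, hbs, hlength, hr⟩ : ∃ (bs : List Bool) (r : List (Option Bool)),
      bs.map some ++ r = w ∧ bs.length = es.length ∧ r.head?.join = none := by
    cases l with
    | nil => exact ⟨[], [], rfl, by simp [hempty rfl], rfl⟩
    | cons I l =>
      exact ⟨es.map fun e => decide (e ∈ I.1), none :: (ClosureSys.encodeSet es I.2 ++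
        ClosureSys.encodeBasis es l), by simp [hw, ClosureSys.encodeBasis, ClosureSys.encodeSet],
        by simp, rfl⟩
  have hcells : (setup es.length [] w w).withSets es ∅ es.toFinset ∅ = setup es.length [] w w :=
    Memory.ext rfl rfl (List.eq_replicate_iff.2 ⟨by simp [Memory.withSets, cells],
      by simp +contextual [Memory.withSets, cells]⟩) rfl
  have hrounds := exec_rounds (m := setup es.length [] w w) hes hpremise ⟨rfl, rfl⟩ ⟨rfl, rfl⟩
    ⟨rfl, rfl⟩ ⟨rfl, rfl⟩ rfl
  rw [hcells] at hrounds
  have hsetup := exec_setup bs hbs hr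
  rw [hlength] at hsetup
  have h := hsetup.seq (hrounds.seq (exec_verdict w _ _ _))
  simpa only [programTime, ← length_encodeBasis] using! h

theorem exec_program (hes : es.Nodup) (hpremise : ∀ I ∈ l, I.1 ⊆ es.toFinset) :
    Exec program (setup 0 [] (ClosureSys.encodeBasis es l) []).state
      (answerState (es.toFinset ⊆ safeSet es l)) (programTime es.length l.length) := by
  by_cases hl : l = []
  · -- The empty input does not reveal `es`: the run is the one for no elements.
    subst hl
    have hsafe : es.toFinset ⊆ safeSet es [] := by
      cases es <;> simp [safeSet, Function.iterate_succ_apply']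
    have h := exec_program_of_elements (es := ([] : List α)) (l := []) (by simp) (by simp) (by simp)
    simp only [hsafe]
    refine h.mono ?_
    simp only [programTime, List.length_nil, mul_zero, zero_mul, passTime, roundTime, closeTime]
    omega
  · exact exec_program_of_elements hes hpremise fun h => absurd h hl

/-- The machine that performs `program`. -/
def machine : Turing.TM2ComputableAux (Option Bool) Bool where
  tm :=
    { K := Stack
      k₀ := .right .outer
      k₁ := .out
      Γ := Sym
      Λ := Label program
      main := entry program
      ΛFin := labelFintype program
      σ := Reg × Bool
      initialState := (⟨none, default, 0, fun _ => false⟩, false)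
      Γk₀Fin := inferInstanceAs (Fintype (Option Bool))
      m := code program id .halt }
  inputAlphabet := Equiv.refl _
  outputAlphabet := Equiv.refl _

theorem machine_outputs {w : List (Option Bool)} {b : Bool} {t : ℕ}
    (h : Exec program (setup 0 [] w []).state (answerState b) t) :
    Nonempty (Turing.TM2OutputsInTime machine.tm (w.map machine.inputAlphabet.invFun)
      (some ((Computability.encodeBool b).map machine.outputAlphabet.invFun)) t) := by
  have hinit : Turing.initList machine.tm (w.map machine.inputAlphabet.invFun) =
      ⟨some (entry program), ((setup 0 [] w []).state.1, false), (setup 0 [] w []).state.2⟩ := by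
    rw [show w.map machine.inputAlphabet.invFun = w from List.map_id w]
    refine congrArg (Turing.TM2.Cfg.mk _ _) (funext fun k => ?_)
    rcases k with (_ | _) | (_ | _) | _ | _ | _ <;> rfl
  have hhalt : Turing.haltList machine.tm
      ((Computability.encodeBool b).map machine.outputAlphabet.invFun) =
      ⟨none, ((answerState b).1, false), (answerState b).2⟩ := by
    refine congrArg (Turing.TM2.Cfg.mk _ _) (funext fun k => ?_)
    rcases k with (_ | _) | (_ | _) | _ | _ | _ <;> rfl
  rw [Turing.TM2OutputsInTime, hinit, Option.map_some, hhalt]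
  exact h.reachesIn (M := code program id .halt) id .halt fun _ => rfl

end DCycleMachine

/-! ### Critical sets, minimal covers and the `D`-relation -/

namespace ClosureSys

variable {S : Type*} {φ : ClosureOperator (Finset S)}

theorem mem_closure_singleton (x : S) : x ∈ φ {x} :=
  φ.le_closure {x} (Finset.mem_singleton_self x)

theorem closure_singleton_subset_iff {x : S} {A : Finset S} : φ {x} ⊆ φ A ↔ x ∈ φ A :=
  φ.le_closure_iff.symm.trans Finset.singleton_subset_iff

/-- Down-sets of the preorder `y ∈ φ {z}` on `S`. -/
def IsDown (φ : ClosureOperator (Finset S)) (W : Finset S) : Prop :=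
  ∀ w ∈ W, φ {w} ⊆ W

variable [DecidableEq S]

/-- The down-set generated by `X`. -/
def below (φ : ClosureOperator (Finset S)) (X : Finset S) : Finset S :=
  X.biUnion fun y => φ {y}

theorem mem_below {X : Finset S} {x : S} : x ∈ below φ X ↔ ∃ y ∈ X, x ∈ φ {y} :=
  Finset.mem_biUnion

theorem isDown_below (X : Finset S) : IsDown φ (below φ X) := fun _ hw _ hx => by
  obtain ⟨y, hy, hwy⟩ := mem_below.1 hw
  exact mem_below.2 ⟨y, hy, closure_singleton_subset_iff.2 hwy hx⟩

theorem subset_below (X : Finset S) : X ⊆ below φ X := fun x hx =>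
  mem_below.2 ⟨x, hx, mem_closure_singleton x⟩

theorem below_subset_closure (X : Finset S) : below φ X ⊆ φ X :=
  Finset.biUnion_subset.2 fun _ hy => φ.monotone (Finset.singleton_subset_iff.2 hy)

theorem IsStandard.antisymm (hφ : IsStandard φ) {x y : S} (hxy : x ∈ φ {y}) (hyx : y ∈ φ {x}) :
    x = y := by
  by_contra hne
  have hx : {x} ⊆ φ {y} \ {y} := by simp [hxy, hne]
  simpa using φ.closure_min hx (hφ.2 y) hyx

theorem isClosed_inter {A B : Finset S} (hA : φ.IsClosed A) (hB : φ.IsClosed B) :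
    φ.IsClosed (A ∩ B) :=
  φ.isClosed_iff_closure_le.2 (Finset.subset_inter (φ.closure_min Finset.inter_subset_left hA)
    (φ.closure_min Finset.inter_subset_right hB))

/-! #### The canonical basis -/

theorem IsQuasiClosed.exists_isCritical {Q : Finset S} (hQ : IsQuasiClosed φ Q) :
    ∃ C ⊆ Q, IsCritical φ C ∧ φ C = φ Q := by
  obtain ⟨C, hCQ, hC⟩ := exists_minimal_le_of_wellFoundedLT
    (fun C => IsQuasiClosed φ C ∧ φ C = φ Q) Q ⟨hQ, rfl⟩
  exact ⟨C, hCQ, ⟨hC.prop.1, fun R hRC hR hφR =>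
    hRC.antisymm (hC.le_of_le ⟨hR, hφR.trans hC.prop.2⟩ hRC)⟩, hC.prop.2⟩

theorem isClosed_of_isCritical {A : Finset S} (hA : ∀ C, IsCritical φ C → C ⊆ A → φ C ⊆ A) :
    φ.IsClosed A := by
  by_contra hcl
  obtain ⟨F, -, hF⟩ := exists_minimal_le_of_wellFoundedLT
    (fun F => φ.IsClosed F ∧ ¬ φ (A ∩ F) ⊆ A) (φ A) ⟨φ.isClosed_closure A, fun h => hcl <|
      φ.isClosed_iff_closure_le.2 (by rwa [Finset.inter_eq_left.2 (φ.le_closure A)] at h)⟩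
  have hquasi : IsQuasiClosed φ (A ∩ F) := by
    refine ⟨fun h => hF.prop.2 (h.closure_eq.trans_le Finset.inter_subset_left),
      fun X hX hAFX => ?_⟩
    have hFX : φ.IsClosed (F ∩ X) := isClosed_inter hF.prop.1 hX
    have hAX : φ (A ∩ (F ∩ X)) ⊆ A := by
      by_contra h
      have hle : F ≤ F ∩ X := hF.le_of_le ⟨hFX, h⟩ Finset.inter_subset_left
      exact hAFX (Finset.inter_subset_right.trans (hle.trans Finset.inter_subset_right))
    rw [Finset.inter_assoc]
    exact φ.isClosed_iff_closure_le.2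
      (Finset.subset_inter hAX (φ.closure_min Finset.inter_subset_right hFX))
  obtain ⟨C, hC, hcrit, hφC⟩ := hquasi.exists_isCritical
  exact hF.prop.2 (hφC ▸ hA C hcrit (hC.trans Finset.inter_subset_left))

theorem IsCritical.nonempty {C : Finset S} (hφ : φ ∅ = ∅) (hC : IsCritical φ C) : C.Nonempty :=
  Finset.nonempty_iff_ne_empty.2 fun h => hC.1.1 (h ▸ φ.isClosed_iff.2 hφ)

theorem isQuasiClosed_singleton {c : S} (hφ : φ ∅ = ∅) (hc : ¬ φ.IsClosed {c}) :
    IsQuasiClosed φ {c} :=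
  ⟨hc, fun X _ hX => by
    rw [Finset.singleton_inter_of_notMem (by simpa using hX)]
    exact φ.isClosed_iff.2 hφ⟩

theorem IsCritical.isDown {C : Finset S} (hφ : φ ∅ = ∅) (hC : IsCritical φ C)
    (hcard : 2 ≤ C.card) : IsDown φ C := by
  intro c hc
  have hcC : {c} ⊆ C := Finset.singleton_subset_iff.2 hc
  by_cases hCc : C ⊆ φ {c}
  · have hne : {c} ≠ C := by
      rintro rfl
      simp at hcard
    have hφc : φ {c} = φ C := (φ.monotone hcC).antisymm (φ.le_closure_iff.1 hCc)
    refine absurd (hC.2 {c} hcC (isQuasiClosed_singleton hφ fun hcl => hne ?_) hφc) hne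
    exact hcC.antisymm (hcl.closure_eq ▸ hCc)
  · have hclosed : φ.IsClosed (C ∩ φ {c}) := hC.1.2 _ (φ.isClosed_closure _) hCc
    exact (φ.closure_min (Finset.singleton_subset_iff.2 (Finset.mem_inter.2
      ⟨hc, mem_closure_singleton c⟩)) hclosed).trans Finset.inter_subset_left

theorem mem_canonicalBasis [Fintype S] {I : Finset S × Finset S} :
    I ∈ canonicalBasis φ ↔ IsCritical φ I.1 ∧ I.2 = φ I.1 \ I.1 := by
  simp only [canonicalBasis, Finset.mem_image, Finset.mem_filter, Finset.mem_univ, true_and,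
    Prod.ext_iff]
  exact ⟨fun ⟨C, hC, h₁, h₂⟩ => h₁ ▸ ⟨hC, h₂.symm⟩, fun h => ⟨I.1, h.1, rfl, h.2.symm⟩⟩

/-! #### Minimal covers -/

theorem IsStandard.exists_isMinCover (hφ : IsStandard φ) {C : Finset S} {x : S}
    (hC : IsDown φ C) (hx : x ∈ φ C) (hxC : x ∉ C) : ∃ Z ⊆ C, IsMinCover φ Z x := by
  obtain ⟨W, hWC, hW⟩ := exists_minimal_le_of_wellFoundedLT
    (fun W => IsDown φ W ∧ x ∈ φ W) C ⟨hC, hx⟩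
  obtain ⟨Z, hZW, hZ⟩ := exists_minimal_le_of_wellFoundedLT
    (fun Z => W ⊆ below φ Z) W (subset_below W)
  have hxZ : x ∈ φ Z :=
    φ.closure_min (hZ.prop.trans (below_subset_closure Z)) (φ.isClosed_closure Z) hW.prop.2
  refine ⟨Z, hZW.trans hWC, ⟨hxZ, fun y hy hxy => hxC (hC y (hWC (hZW hy)) hxy)⟩,
    fun Y hxY hYZ z hz => ?_⟩
  have hYW : below φ Y ⊆ W := Finset.biUnion_subset.2 fun y hy => by
    obtain ⟨z, hz, hyz⟩ := hYZ y hy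
    exact (closure_singleton_subset_iff.2 hyz).trans (hW.prop.1 z (hZW hz))
  have hWY : W ⊆ below φ Y :=
    hW.le_of_le ⟨isDown_below Y, φ.monotone (subset_below Y) hxY⟩ hYW
  obtain ⟨y, hy, hzy⟩ := mem_below.1 (hWY (hZW hz))
  obtain ⟨z', hz', hyz'⟩ := hYZ y hy
  have hzz' : z ∈ φ {z'} := closure_singleton_subset_iff.2 hyz' hzy
  have heq : z' = z := by
    by_contra hne
    have herase : W ⊆ below φ (Z.erase z) := fun w hw => by
      obtain ⟨u, hu, hwu⟩ := mem_below.1 (hZ.prop hw)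
      by_cases huz : u = z
      · exact mem_below.2 ⟨z', Finset.mem_erase.2 ⟨hne, hz'⟩,
          closure_singleton_subset_iff.2 hzz' (huz ▸ hwu)⟩
      · exact mem_below.2 ⟨u, Finset.mem_erase.2 ⟨huz, hu⟩, hwu⟩
    exact Finset.notMem_erase z Z (hZ.le_of_le herase (Finset.erase_subset z Z) hz)
  exact hφ.antisymm hzy (heq ▸ hyz') ▸ hy

/-! #### Supported elements -/

/-- `x` is safe relative to `T`: whatever critical set with at least two elements implies `x`
without containing it, its elements in `T` already imply `x`. The machine tests this condition
instead of whether `T` contains all `y` with `x D y`. -/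
def Supported (φ : ClosureOperator (Finset S)) (T : Finset S) (x : S) : Prop :=
  ∀ C, IsCritical φ C → 2 ≤ C.card → x ∈ φ C \ C → x ∈ φ (C ∩ T)

theorem Supported.mono {T T' : Finset S} (hT : T ⊆ T') {x : S} (hx : Supported φ T x) :
    Supported φ T' x := fun C hC hcard hxC =>
  φ.monotone (Finset.inter_subset_inter_left hT) (hx C hC hcard hxC)

theorem Supported.mem_or_mem_closure_inter (hφ : φ ∅ = ∅) {T W : Finset S}
    (hT : ∀ t ∈ T, Supported φ T t) (hW : IsDown φ W) {x : S} (hx : Supported φ T x)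
    (hxW : x ∈ φ W) : x ∈ W ∨ x ∈ φ (W ∩ T) := by
  classical
  let V := (φ W).filter fun z => ∀ u ∈ φ {z}, Supported φ T u → u ∈ W ∨ u ∈ φ (W ∩ T)
  have hWV : W ⊆ V := fun w hw => Finset.mem_filter.2
    ⟨φ.le_closure W hw, fun u hu _ => .inl (hW w hw hu)⟩
  have hV {v : S} (hv : v ∈ V) (hvT : Supported φ T v) : v ∈ W ∨ v ∈ φ (W ∩ T) :=
    (Finset.mem_filter.1 hv).2 v (mem_closure_singleton v) hvT
  have hclosed : φ.IsClosed V := by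
    refine isClosed_of_isCritical fun C hC hCV z hz => ?_
    refine Finset.mem_filter.2 ⟨φ.closure_min (hCV.trans (Finset.filter_subset _ _))
      (φ.isClosed_closure W) hz, fun u hu huT => ?_⟩
    replace hu : u ∈ φ C := closure_singleton_subset_iff.2 hz hu
    by_cases huC : u ∈ C
    · exact hV (hCV huC) huT
    rcases Nat.lt_or_ge C.card 2 with hcard | hcard
    · obtain ⟨c, rfl⟩ := Finset.card_eq_one.1
        (le_antisymm (Nat.lt_succ_iff.1 hcard) (hC.nonempty hφ).card_pos)
      exact (Finset.mem_filter.1 (hCV (Finset.mem_singleton_self c))).2 u hu huT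
    · refine .inr (φ.closure_min (fun c hc => ?_) (φ.isClosed_closure _)
        (huT C hC hcard (Finset.mem_sdiff.2 ⟨hu, huC⟩)))
      obtain ⟨hcC, hcT⟩ := Finset.mem_inter.1 hc
      exact (hV (hCV hcC) (hT c hcT)).elim
        (fun hcW => φ.le_closure _ (Finset.mem_inter.2 ⟨hcW, hcT⟩)) id
  exact hV (φ.closure_min hWV hclosed hxW) hx

theorem DRel.mem_of_supported (hφ : φ ∅ = ∅) {T : Finset S} (hT : ∀ t ∈ T, Supported φ T t)
    {x y : S} (hxy : DRel φ x y) (hx : Supported φ T x) : y ∈ T := by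
  obtain ⟨Z, ⟨⟨hxZ, hZ⟩, hmin⟩, hy⟩ := hxy
  have hxW : x ∉ below φ Z := fun h => (mem_below.1 h).elim fun z hz => hZ z hz.1 hz.2
  have hxT : x ∈ φ (below φ Z ∩ T) := (hx.mem_or_mem_closure_inter hφ hT (isDown_below Z)
    (φ.monotone (subset_below Z) hxZ)).resolve_left hxW
  exact (Finset.mem_inter.1 (hmin _ hxT (fun w hw => mem_below.1 (Finset.mem_inter.1 hw).1) hy)).2

theorem IsStandard.supported_of_dRel (hφ : IsStandard φ) {T : Finset S} {x : S}
    (hx : ∀ y, DRel φ x y → y ∈ T) : Supported φ T x := fun C hC hcard hxC => by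
  obtain ⟨hxφ, hxC⟩ := Finset.mem_sdiff.1 hxC
  obtain ⟨Z, hZC, hZ⟩ := hφ.exists_isMinCover (hC.isDown hφ.1 hcard) hxφ hxC
  exact φ.monotone (fun z hz => Finset.mem_inter.2 ⟨hZC hz, hx z ⟨Z, hZ, hz⟩⟩) hZ.1.1

end ClosureSys

/-! ### Iterating on finite sets -/

theorem isFixedPt_iterate_card {α : Type*} {f : Finset α → Finset α} {A E : Finset α}
    (hmono : Monotone fun k => f^[k] A) (hE : ∀ k, f^[k] A ⊆ E) :
    Function.IsFixedPt f (f^[E.card] A) := by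
  have hstable {k : ℕ} (hk : (f^[k] A).card = (f^[k + 1] A).card) :
      f^[k] A = f^[k + 1] A :=
    Finset.eq_of_subset_of_card_le (hmono k.le_succ) hk.ge
  have hcard : (f^[E.card + 1] A).card = (f^[E.card] A).card :=
    Nat.stabilises_of_monotone (f := fun k => (f^[k] A).card)
      (fun _ _ h => Finset.card_le_card (hmono h)) (fun k => Finset.card_le_card (hE k))
      (fun k hk => by
        have h := hstable hk
        simp only [Function.iterate_succ_apply'] at h ⊢
        rw [← h, ← h]) (Nat.le_succ _)
  exact (Function.iterate_succ_apply' f _ A).symm.trans (hstable hcard.symm).symm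

namespace DCycleMachine

variable {S : Type*} [DecidableEq S] {l : List (Finset S × Finset S)} {A E X : Finset S}

/-- `A` satisfies the implications in `l`. -/
def IsModel (l : List (Finset S × Finset S)) (A : Finset S) : Prop :=
  ∀ I ∈ l, I.1 ⊆ A → I.2 ⊆ A

theorem subset_fire (A : Finset S) (I : Finset S × Finset S) : A ⊆ fire A I := by
  unfold fire
  split_ifs
  exacts [Finset.subset_union_left, subset_rfl]

theorem subset_foldl_fire (l : List (Finset S × Finset S)) (A : Finset S) :
    A ⊆ l.foldl fire A := by
  induction l generalizing A with
  | nil => exact subset_rfl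
  | cons I l ih => exact (subset_fire A I).trans (ih _)

theorem foldl_fire_subset (hA : A ⊆ X) (hX : IsModel l X) :
    l.foldl fire A ⊆ X := by
  induction l generalizing A with
  | nil => exact hA
  | cons I l ih =>
    refine ih ?_ fun J hJ => hX J (List.mem_cons_of_mem I hJ)
    unfold fire
    split_ifs with h
    · exact Finset.union_subset hA (hX I List.mem_cons_self (h.trans hA))
    · exact hA

theorem isModel_of_foldl_fire_eq (h : l.foldl fire A = A) : IsModel l A := by
  induction l with
  | nil => exact fun _ hI => absurd hI List.not_mem_nil
  | cons I l ih =>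
    have hI : fire A I = A := ((subset_foldl_fire l _).trans h.subset).antisymm (subset_fire A I)
    rw [List.foldl_cons, hI] at h
    refine List.forall_mem_cons.2 ⟨fun hIA => ?_, ih h⟩
    rw [fire, if_pos hIA] at hI
    exact Finset.union_eq_left.1 hI

theorem chase_subset (hA : A ⊆ X) (hX : IsModel l X) (n : ℕ) :
    chase l n A ⊆ X := by
  induction n with
  | zero => exact hA
  | succ n ih =>
    rw [chase, Function.iterate_succ_apply']
    exact foldl_fire_subset ih hX

theorem monotone_chase (l : List (Finset S × Finset S)) (A : Finset S) :
    Monotone fun n => chase l n A :=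
  monotone_nat_of_le_succ fun n => by
    unfold chase
    rw [Function.iterate_succ_apply']
    exact subset_foldl_fire l _

theorem isModel_chase_card (hA : A ⊆ E) (hE : ∀ I ∈ l, I.2 ⊆ E) :
    IsModel l (chase l E.card A) :=
  isModel_of_foldl_fire_eq
    (isFixedPt_iterate_card (monotone_chase l A) (chase_subset hA fun I hI _ => hE I hI))

theorem chase_eq_closure {φ : ClosureOperator (Finset S)}
    (hφ : ∀ A, φ.IsClosed A ↔ IsModel l A) (hA : A ⊆ E) (hE : ∀ I ∈ l, I.2 ⊆ E) :
    chase l E.card A = φ A :=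
  (chase_subset (φ.le_closure A) ((hφ _).1 (φ.isClosed_closure A)) _).antisymm
    (φ.closure_min (monotone_chase l A (Nat.zero_le _)) ((hφ _).2 (isModel_chase_card hA hE)))

theorem mem_foldl_cut {cl : Finset S → Finset S} {T U : Finset S} {x : S} :
    x ∈ l.foldl (cut cl T) U ↔
      x ∈ U ∧ ∀ I ∈ l, 2 ≤ I.1.card → x ∈ I.2 → x ∈ cl (I.1 ∩ T) := by
  induction l generalizing U with
  | nil => simp
  | cons I l ih =>
    rw [List.foldl_cons, ih, List.forall_mem_cons, ← and_assoc]
    refine and_congr_left fun _ => ?_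
    unfold cut
    split_ifs with h <;> simp [h]

end DCycleMachine

namespace ClosureSys

variable {S : Type*} {φ : ClosureOperator (Finset S)}

/-! ### The fixed-point criterion -/

theorem DRel.ne {x y : S} (h : DRel φ x y) : x ≠ y := by
  rintro rfl
  obtain ⟨Z, ⟨⟨-, hZ⟩, -⟩, hx⟩ := h
  exact hZ x hx (mem_closure_singleton x)

theorem withoutDCycles_of_wellFounded (h : WellFounded fun b a => DRel φ a b) :
    WithoutDCycles φ := by
  rintro ⟨n, x, hn, hx, hxn⟩
  obtain ⟨-, ⟨i, hi, hin, rfl⟩, hmin⟩ := h.has_min {a | ∃ i, 1 ≤ i ∧ i < n ∧ x i = a}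
    ⟨x 1, 1, le_rfl, by omega, rfl⟩
  have hd := hx i hi hin
  rcases Nat.lt_or_ge (i + 1) n with hlt | hge
  · exact hmin _ ⟨i + 1, by omega, hlt, rfl⟩ hd
  · rw [show i + 1 = n by omega, ← hxn] at hd
    exact hmin _ ⟨1, le_rfl, by omega, rfl⟩ hd

theorem WithoutDCycles.wellFounded [Finite S] (h : WithoutDCycles φ) :
    WellFounded fun b a => DRel φ a b := by
  rw [wellFounded_iff_isEmpty_descending_chain]
  refine ⟨fun ⟨f, hf⟩ => ?_⟩
  obtain ⟨i, j, hne, hij⟩ := Finite.exists_ne_map_eq_of_infinite f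
  wlog hlt : i < j generalizing i j
  · exact this j i hne.symm hij.symm (by omega)
  have hj : i + 1 ≠ j := by
    rintro rfl
    exact (hf i).ne hij
  refine h ⟨j - i + 1, fun k => f (i + (k - 1)), by omega, fun k hk _ => ?_, ?_⟩
  · simpa only [show i + (k - 1) + 1 = i + (k + 1 - 1) by omega] using hf (i + (k - 1))
  · simp [hij, show i + (j - i) = j by omega]

variable [DecidableEq S] {E : Finset S}

open Classical in
/-- The elements of `E` supported by `T`. -/
noncomputable def safeStep (φ : ClosureOperator (Finset S)) (E T : Finset S) : Finset S :=
  E.filter (Supported φ T)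

theorem mem_safeStep {T : Finset S} {x : S} : x ∈ safeStep φ E T ↔ x ∈ E ∧ Supported φ T x := by
  simp [safeStep]

theorem safeStep_mono (φ : ClosureOperator (Finset S)) (E : Finset S) :
    Monotone (safeStep φ E) := fun _ _ hT _ hx =>
  mem_safeStep.2 ((mem_safeStep.1 hx).imp_right (Supported.mono hT))

theorem monotone_iterate_safeStep (φ : ClosureOperator (Finset S)) (E : Finset S) :
    Monotone fun k => (safeStep φ E)^[k] ∅ :=
  (safeStep_mono φ E).monotone_iterate_of_le_map (Finset.empty_subset _)

theorem iterate_safeStep_subset (k : ℕ) : (safeStep φ E)^[k] ∅ ⊆ E := by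
  cases k with
  | zero => exact Finset.empty_subset E
  | succ k =>
    rw [Function.iterate_succ_apply']
    exact fun _ hx => (mem_safeStep.1 hx).1

theorem supported_of_mem_iterate_safeStep {k : ℕ} {x : S} (hx : x ∈ (safeStep φ E)^[k + 1] ∅) :
    Supported φ ((safeStep φ E)^[k] ∅) x := by
  rw [Function.iterate_succ_apply'] at hx
  exact (mem_safeStep.1 hx).2

theorem acc_of_mem_iterate_safeStep (hφ : φ ∅ = ∅) {k : ℕ} {x : S}
    (hx : x ∈ (safeStep φ E)^[k] ∅) : Acc (fun b a => DRel φ a b) x := by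
  induction k generalizing x with
  | zero => exact absurd hx (Finset.notMem_empty x)
  | succ k ih =>
    have hself : ∀ t ∈ (safeStep φ E)^[k] ∅, Supported φ ((safeStep φ E)^[k] ∅) t := fun t ht =>
      supported_of_mem_iterate_safeStep (monotone_iterate_safeStep φ E k.le_succ ht)
    exact ⟨x, fun y hxy =>
      ih (hxy.mem_of_supported hφ hself (supported_of_mem_iterate_safeStep hx))⟩

theorem IsStandard.subset_iterate_safeStep_iff [Finite S] (hφ : IsStandard φ)
    (hE : ∀ x y, DRel φ x y → y ∈ E) :
    E ⊆ (safeStep φ E)^[E.card] ∅ ↔ WithoutDCycles φ := by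
  refine ⟨fun h => withoutDCycles_of_wellFounded
    ⟨fun _ => ⟨_, fun y hxy => acc_of_mem_iterate_safeStep hφ.1 (h (hE _ y hxy))⟩⟩, fun h x => ?_⟩
  have hfix := isFixedPt_iterate_card (monotone_iterate_safeStep φ E) iterate_safeStep_subset
  induction x using h.wellFounded.induction with
  | _ x ih =>
    intro hx
    rw [← hfix.eq]
    exact mem_safeStep.2 ⟨hx, hφ.supported_of_dRel fun y hxy => ih y hxy (hE x y hxy)⟩

/-! ### The criterion on the canonical basis -/

section CanonicalBasis

variable [Fintype S] {es : List S} {l : List (Finset S × Finset S)}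

theorem isClosed_iff_isModel (hl : l.toFinset = canonicalBasis φ) (A : Finset S) :
    φ.IsClosed A ↔ DCycleMachine.IsModel l A := by
  simp only [DCycleMachine.IsModel, ← List.mem_toFinset, hl, mem_canonicalBasis]
  refine ⟨fun hA I hI hIA => ?_, fun hA => isClosed_of_isCritical fun C hC hCA => ?_⟩
  · rw [hI.2]
    exact Finset.sdiff_subset.trans (φ.closure_min hIA hA)
  · exact (sdiff_le_iff.1 (hA (C, φ C \ C) ⟨hC, rfl⟩ hCA)).trans
      (Finset.union_subset hCA subset_rfl)

theorem union_subset_occurring {I : Finset S × Finset S} (hI : I ∈ canonicalBasis φ) :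
    I.1 ∪ I.2 ⊆ occurring (canonicalBasis φ) :=
  Finset.subset_biUnion_of_mem (fun I : Finset S × Finset S => I.1 ∪ I.2) hI

theorem IsCritical.subset_occurring {C : Finset S} (hC : IsCritical φ C) :
    C ⊆ occurring (canonicalBasis φ) :=
  Finset.subset_union_left.trans
    (union_subset_occurring (I := (C, φ C \ C)) (mem_canonicalBasis.2 ⟨hC, rfl⟩))

theorem DRel.mem_occurring (hφ : φ ∅ = ∅) {x y : S} (hxy : DRel φ x y) :
    y ∈ occurring (canonicalBasis φ) := by
  have hsupp (z : S) : Supported φ (occurring (canonicalBasis φ)) z := fun C hC _ hz => by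
    rw [Finset.inter_eq_left.2 hC.subset_occurring]
    exact (Finset.mem_sdiff.1 hz).1
  exact hxy.mem_of_supported hφ (fun t _ => hsupp t) (hsupp x)

theorem foldl_cut_eq_safeStep (hes : es.Nodup) (hl : l.toFinset = canonicalBasis φ)
    (hocc : occurring (canonicalBasis φ) ⊆ es.toFinset) (T : Finset S) :
    l.foldl (DCycleMachine.cut (DCycleMachine.chase l es.length) T) es.toFinset =
      safeStep φ es.toFinset T := by
  have hsub (I) (hI : I ∈ l) : I.1 ∪ I.2 ⊆ es.toFinset :=
    (union_subset_occurring (hl ▸ List.mem_toFinset.2 hI)).trans hocc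
  have hchase (I) (hI : I ∈ l) : DCycleMachine.chase l es.length (I.1 ∩ T) = φ (I.1 ∩ T) := by
    rw [← List.toFinset_card_of_nodup hes]
    exact DCycleMachine.chase_eq_closure (isClosed_iff_isModel hl)
      (Finset.inter_subset_left.trans (Finset.union_subset_left (hsub I hI)))
      fun J hJ => Finset.union_subset_right (hsub J hJ)
  have hmem (I) : I ∈ l ↔ IsCritical φ I.1 ∧ I.2 = φ I.1 \ I.1 := by
    rw [← List.mem_toFinset, hl, mem_canonicalBasis]
  ext x
  rw [DCycleMachine.mem_foldl_cut, mem_safeStep]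
  refine and_congr_right fun _ => ⟨fun h C hC hcard hx => ?_, fun h I hI hcard hx => ?_⟩
  · have hCl : (C, φ C \ C) ∈ l := (hmem _).2 ⟨hC, rfl⟩
    exact hchase _ hCl ▸ h _ hCl hcard hx
  · obtain ⟨hC, hI₂⟩ := (hmem I).1 hI
    exact hchase I hI ▸ h I.1 hC hcard (hI₂ ▸ hx)

theorem IsStandard.subset_safeSet_iff (hφ : IsStandard φ) (hes : es.Nodup)
    (hocc : occurring (canonicalBasis φ) ⊆ es.toFinset) (hl : l.toFinset = canonicalBasis φ) :
    es.toFinset ⊆ DCycleMachine.safeSet es l ↔ WithoutDCycles φ := by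
  rw [← hφ.subset_iterate_safeStep_iff fun x y hxy => hocc (hxy.mem_occurring hφ.1),
    DCycleMachine.safeSet, funext (foldl_cut_eq_safeStep hes hl hocc),
    List.toFinset_card_of_nodup hes]

end CanonicalBasis

end ClosureSys

/-! ### Comparison with the lattice of closed sets -/

namespace ClosureSys

section Lattice

variable {S : Type*} {φ : ClosureOperator (Finset S)}

theorem toCloseds_le_iff {A : Finset S} {c : φ.Closeds} : φ.toCloseds A ≤ c ↔ A ⊆ c.1 :=
  φ.gi.gc A c

/-- The closed set generated by an element. -/
def principal (φ : ClosureOperator (Finset S)) (i : S) : φ.Closeds :=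
  φ.toCloseds {i}

theorem principal_le_iff {i : S} {c : φ.Closeds} : principal φ i ≤ c ↔ i ∈ c.1 :=
  toCloseds_le_iff.trans Finset.singleton_subset_iff

variable [DecidableEq S]

theorem IsStandard.principal_injective (hφ : IsStandard φ) : Function.Injective (principal φ) :=
  fun _ _ h => hφ.antisymm (principal_le_iff.1 h.le) (principal_le_iff.1 h.ge)

theorem IsStandard.le_of_lt_principal (hφ : IsStandard φ) {i : S} {c : φ.Closeds}
    (hc : c < principal φ i) : c ≤ ⟨φ {i} \ {i}, hφ.2 i⟩ := fun x hx => by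
  refine Finset.mem_sdiff.2 ⟨hc.le hx, fun hxi => hc.not_ge (principal_le_iff.2 ?_)⟩
  rwa [← Finset.mem_singleton.1 hxi]

theorem IsStandard.supIrred_principal (hφ : IsStandard φ) (i : S) : SupIrred (principal φ i) := by
  refine ⟨fun h => ?_, fun b c hbc => ?_⟩
  · have hi : i ∈ φ ∅ := principal_le_iff.1 (h bot_le)
    simp [hφ.1] at hi
  · by_contra! hne
    have hle : b ⊔ c ≤ ⟨φ {i} \ {i}, hφ.2 i⟩ :=
      sup_le (hφ.le_of_lt_principal ((hbc ▸ le_sup_left).lt_of_ne hne.1))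
        (hφ.le_of_lt_principal ((hbc ▸ le_sup_right).lt_of_ne hne.2))
    rw [hbc, principal_le_iff] at hle
    simp at hle

open Classical in
theorem sup_image_principal (X : Finset S) :
    (X.image (principal φ)).sup id = φ.toCloseds X :=
  eq_of_forall_ge_iff fun c => by
    simp only [Finset.sup_le_iff, Finset.forall_mem_image, id_eq, principal_le_iff,
      toCloseds_le_iff]
    rfl

open Classical in
theorem principal_le_sup_image_iff {x : S} {X : Finset S} :
    principal φ x ≤ (X.image (principal φ)).sup id ↔ x ∈ φ X := by
  rw [sup_image_principal]
  exact principal_le_iff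

open Classical in
theorem refines_image_principal_iff {X Y : Finset S} :
    Refines (Y.image (principal φ)) (X.image (principal φ)) ↔ ∀ y ∈ Y, ∃ z ∈ X, y ∈ φ {z} := by
  simp only [Refines, Finset.forall_mem_image, Finset.exists_mem_image, principal_le_iff]
  rfl

theorem exists_principal_eq {a : φ.Closeds} (ha : SupIrred a) : ∃ i, principal φ i = a := by
  classical
  have hsup : (a.1.image (principal φ)).sup id = a := by
    rw [sup_image_principal]
    exact Subtype.ext a.2.closure_eq
  obtain ⟨b, hb, rfl⟩ := ha.finset_sup_eq hsup
  obtain ⟨i, -, rfl⟩ := Finset.mem_image.1 hb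
  exact ⟨i, rfl⟩

open Classical in
theorem exists_image_principal_eq {Y : Finset φ.Closeds} (hY : ∀ y ∈ Y, SupIrred y) :
    ∃ X : Finset S, X.image (principal φ) = Y := by
  have hrange : (Y : Set φ.Closeds) ⊆ principal φ '' Set.univ := fun y hy =>
    (exists_principal_eq (hY y hy)).imp fun _ h => ⟨Set.mem_univ _, h⟩
  obtain ⟨X, -, hX⟩ := Finset.subset_set_image_iff.1 hrange
  exact ⟨X, hX⟩

open Classical in
theorem IsStandard.forall_mem_image_supIrred (hφ : IsStandard φ) (X : Finset S) :
    ∀ a ∈ X.image (principal φ), SupIrred a :=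
  Finset.forall_mem_image.2 fun i _ => hφ.supIrred_principal i

open Classical in
theorem IsStandard.isLatticeMinCover_image_iff (hφ : IsStandard φ) {X : Finset S} {x : S} :
    IsLatticeMinCover (X.image (principal φ)) (principal φ x) ↔ IsMinCover φ X x := by
  have hcover : IsLatticeCover (X.image (principal φ)) (principal φ x) ↔ IsCover φ X x := by
    rw [IsLatticeCover, and_iff_right (hφ.forall_mem_image_supIrred X),
      principal_le_sup_image_iff]
    simp only [Finset.forall_mem_image, principal_le_iff]
    rfl
  refine and_congr hcover ⟨fun h Y hxY hYX => ?_, fun h Y hYirr hxY hYX => ?_⟩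
  · exact (Finset.image_subset_image_iff hφ.principal_injective).1
      (h _ (hφ.forall_mem_image_supIrred Y) (principal_le_sup_image_iff.2 hxY)
        (refines_image_principal_iff.2 hYX))
  · obtain ⟨Y, rfl⟩ := exists_image_principal_eq hYirr
    exact Finset.image_subset_image
      (h Y (principal_le_sup_image_iff.1 hxY) (refines_image_principal_iff.1 hYX))

theorem IsStandard.latticeD_principal_iff (hφ : IsStandard φ) {x y : S} :
    LatticeD (principal φ x) (principal φ y) ↔ DRel φ x y := by
  classical
  constructor
  · rintro ⟨-, -, X, hX, hy⟩
    obtain ⟨X, rfl⟩ := exists_image_principal_eq hX.1.1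
    exact ⟨X, hφ.isLatticeMinCover_image_iff.1 hX,
      hφ.principal_injective.mem_finset_image.1 hy⟩
  · rintro ⟨X, hX, hy⟩
    exact ⟨hφ.supIrred_principal x, hφ.supIrred_principal y, X.image (principal φ),
      hφ.isLatticeMinCover_image_iff.2 hX, Finset.mem_image_of_mem _ hy⟩

theorem IsStandard.withoutDCycles_iff_lattice (hφ : IsStandard φ) :
    WithoutDCycles φ ↔ LatticeWithoutDCycles φ.Closeds := by
  refine not_congr ⟨?_, ?_⟩
  · rintro ⟨n, x, hn, hx, hxn⟩
    exact ⟨n, fun i => principal φ (x i), hn,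
      fun i hi hin => hφ.latticeD_principal_iff.2 (hx i hi hin), congrArg _ hxn⟩
  · rintro ⟨n, x, hn, hx, hxn⟩
    obtain ⟨i, -⟩ := exists_principal_eq (hx 1 le_rfl (by omega)).1
    have : Nonempty S := ⟨i⟩
    have hinv {a : φ.Closeds} (ha : SupIrred a) :
        principal φ (Function.invFun (principal φ) a) = a :=
      Function.invFun_eq (exists_principal_eq ha)
    refine ⟨n, fun i => Function.invFun (principal φ) (x i), hn, fun i hi hin => ?_,
      congrArg _ hxn⟩
    have hD := hx i hi hin
    rwa [← hφ.latticeD_principal_iff, hinv hD.1, hinv hD.2.1]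

end Lattice

/-! ### The bound on the number of steps -/

section Size

variable {S : Type*} [DecidableEq S]

theorem card_occurring_le_basisSize (B : Finset (Finset S × Finset S)) :
    (occurring B).card ≤ basisSize B :=
  Finset.card_biUnion_le.trans (Finset.sum_le_sum fun _ _ => Finset.card_union_le _ _)

theorem card_canonicalBasis_le_basisSize [Fintype S] {φ : ClosureOperator (Finset S)}
    (hφ : φ ∅ = ∅) : (canonicalBasis φ).card ≤ basisSize (canonicalBasis φ) := by
  rw [basisSize, Finset.card_eq_sum_ones]
  exact Finset.sum_le_sum fun I hI =>
    ((mem_canonicalBasis.1 hI).1.nonempty hφ).card_pos.trans_le (Nat.le_add_right _ _)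

theorem length_le_card_add_card_sdiff {es : List S} (hes : es.Nodup) (A : Finset S) :
    es.length ≤ A.card + (es.toFinset \ A).card := by
  rw [← List.toFinset_card_of_nodup hes, ← Finset.card_inter_add_card_sdiff es.toFinset A]
  exact Nat.add_le_add_right (Finset.card_le_card Finset.inter_subset_right) _

end Size

end ClosureSys

namespace DCycleMachine

theorem programTime_le_eval {n k N : ℕ} (hn : n ≤ N) (hk : k ≤ N) :
    programTime n k ≤ (programTime Polynomial.X Polynomial.X : Polynomial ℕ).eval N := by
  have hmono : programTime n k ≤ programTime N N := by
    unfold programTime roundTime closeTime passTime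
    gcongr
  simpa [programTime, roundTime, closeTime, passTime] using hmono

end DCycleMachine

/-- One Turing machine `M` and one polynomial `p` serve all finite standard closure systems. The
input is the canonical basis, listed in any order, over any enumeration `es` of elements of `S`
that includes all those occurring in the basis. If `es` lists just the occurring elements, the
number of steps is at most `p (s(Σ_C))`; superfluous elements in `es` are added to the size. -/
theorem theorem6p12 :
    ∃ (M : Turing.TM2ComputableAux (Option Bool) Bool) (p : Polynomial ℕ),
      ∀ (S : Type*) [Fintype S] [DecidableEq S] (φ : ClosureOperator (Finset S)),
        ClosureSys.IsStandard φ →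
        (ClosureSys.WithoutDCycles φ ↔ ClosureSys.LatticeWithoutDCycles φ.Closeds) ∧
        ∀ (es : List S) (l : List (Finset S × Finset S)),
          es.Nodup → ClosureSys.occurring (ClosureSys.canonicalBasis φ) ⊆ es.toFinset →
          l.Nodup → l.toFinset = ClosureSys.canonicalBasis φ →
          ∃ answer : Bool, (answer = true ↔ ClosureSys.WithoutDCycles φ) ∧
            Nonempty (Turing.TM2OutputsInTime M.tm
              ((ClosureSys.encodeBasis es l).map M.inputAlphabet.invFun)
              (some ((Computability.encodeBool answer).map M.outputAlphabet.invFun))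
              (p.eval (ClosureSys.basisSize (ClosureSys.canonicalBasis φ) +
                (es.toFinset \ ClosureSys.occurring (ClosureSys.canonicalBasis φ)).card))) := by
  refine ⟨DCycleMachine.machine, DCycleMachine.programTime .X .X, fun S _ _ φ hφ =>
    ⟨hφ.withoutDCycles_iff_lattice, fun es l hes hocc hl hlφ => ?_⟩⟩
  refine ⟨decide (es.toFinset ⊆ DCycleMachine.safeSet es l),
    decide_eq_true_iff.trans (hφ.subset_safeSet_iff hes hocc hlφ),
    DCycleMachine.machine_outputs ?_⟩
  have hpremise (I) (hI : I ∈ l) : I.1 ⊆ es.toFinset :=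
    (Finset.union_subset_left
      (ClosureSys.union_subset_occurring (hlφ ▸ List.mem_toFinset.2 hI))).trans hocc
  have hlength : es.length ≤ ClosureSys.basisSize (ClosureSys.canonicalBasis φ) +
      (es.toFinset \ ClosureSys.occurring (ClosureSys.canonicalBasis φ)).card :=
    (ClosureSys.length_le_card_add_card_sdiff hes _).trans
      (Nat.add_le_add_right (ClosureSys.card_occurring_le_basisSize _) _)
  have hcard : l.length ≤ ClosureSys.basisSize (ClosureSys.canonicalBasis φ) := by
    rw [← List.toFinset_card_of_nodup hl, hlφ]
    exact ClosureSys.card_canonicalBasis_le_basisSize hφ.1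
  exact (DCycleMachine.exec_program hes hpremise).mono
    (DCycleMachine.programTime_le_eval hlength (hcard.trans (Nat.le_add_right _ _)))
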